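/- Let $R$ be a unital von Neumann regular ring (every $x\in R$ lies in $xRx$) and let $E=(E^0,E^1,\mathrm r,\mathrm s)$ be an arbitrary directed graph. The Leavitt path algebra $L=L_R(E)$ is the (not necessarily unital) associative algebra with coefficients in $R$, commuting with the generators, generated by the vertices $v\in E^0$, the edges $\alpha\in E^1$ and the ghost edges $\alpha^*$, subject to $v_iv_j=\delta_{i,j}v_i$; $\mathrm s(\alpha)\alpha=\alpha\mathrm r(\alpha)=\alpha$; $\mathrm r(\alpha)\alpha^*=\alpha^*\mathrm s(\alpha)=\alpha^*$; $\alpha^*\alpha'=\delta_{\alpha,\alpha'}\mathrm r(\alpha)$; and $\sum_{\mathrm s(\alpha)=v}\alpha\alpha^*=v$ for every vertex $v$ that emits a finite nonzero number of edges. Let $S=M(\mathbb Z,I)\cup\{0\}$ be the Brandt semigroup over the additive group $\mathbb Z$ with index set $I$: its nonzero elements are the triples $(i,n,j)$ with $i,j\in I$, $n\in\mathbb Z$; $(i,m,j)(j,n,l)=(i,m+n,l)$ and all other products are $0$; $(i,n,j)^{-1}=(j,-n,i)$. Let $w$ be a weight mapping for which every vertex has a weight of the form $(i,0,i)$, every edge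 has a weight of the form $(i,1,j)$ with $w(\mathrm s(\alpha))w(\alpha)=w(\alpha)=w(\alpha)w(\mathrm r(\alpha))$, $w(\alpha^*)=w(\alpha)^{-1}$, any two edges whose sources have the same weight have the same weight, and any two edges whose ranges have the same weight have the same weight; extend $w$ multiplicatively. Let $L$ be canonically $S$-graded: for $s\neq0$, $L_s$ is the set of finite sums of elements $c\,\mu\eta^*$ with $c\in R$ and paths $\mu,\eta$ (possibly of length zero) such that $\mathrm r(\mu)=\mathrm r(\eta)$ and $w(\mu\eta^*)=s$; and $L_0=0$. The elements of $\bigcup_{s\in S}L_s$ are called homogeneous, and a one-sided or two-sided ideal $J$ is called homogeneous if $J=\bigoplus_{s\in S}(J\cap L_s)$. Then: a) Every right (left) ideal of $L$ generated by one homogeneous element is generated, as a right (left) ideal, by a homogeneous idempotent. b) Let $e\in S$ be a nonzero idempotent and let $x_1,\dots,x_n$ be homogeneous elements, $x_k\in L_{s_k}$. If $s_ks_k^{-1}=e$ for all $k$, then the right ideal generated by $x_1,\dots,x_n$ is generated by a homogeneous idempotent. If $s_k^{-1}s_k=e$ for all $k$, then the left ideal generated by $x_1,\dots,x_n$ is generated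 by a homogeneous idempotent. c) Every homogeneous right (left) ideal $J$ of $L$ is idempotent, that is, $J^2=J$. d) Every homogeneous two-sided ideal $P$ of $L$ is graded semiprime: if $J$ is a homogeneous two-sided ideal and $J^n\subseteq P$ for some $n\geq1$, then $J\subseteq P$. e) The graded Jacobson radical $J^g(L)$ is zero. Here $J^g(L)$ is the intersection of all graded maximal modular right ideals of $L$; a homogeneous right ideal $J$ is graded modular if there is a homogeneous $u\in L$ such that $ux-x\in J$ for every homogeneous $x\in L$, and it is graded maximal modular if it is moreover maximal among the proper homogeneous right ideals. -/

import Mathlib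

/-- A directed graph with vertex set `V`, edge set `A`, source map `s` and range map `r`. -/
structure DirectedGraph (V A : Type*) where
  s : A → V
  r : A → V

namespace DirectedGraph

variable {V A : Type*}

/-- A regular vertex: neither a sink nor an infinite emitter. -/
def IsRegular (E : DirectedGraph V A) (v : V) : Prop :=
  {α | E.s α = v}.Nonempty ∧ {α | E.s α = v}.Finite

/-- `E.IsPath u l v`: the list of edges `l` is a path from `u` to `v`. The empty list is the
trivial path at a vertex. -/
inductive IsPath (E : DirectedGraph V A) : V → List A → V → Prop
  | nil (v : V) : IsPath E v [] v
  | cons (α : A) (l : List A) (v : V) (h : IsPath E (E.r α) l v) : IsPath E (E.s α) (α :: l) v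

end DirectedGraph

/-- The generators of the Leavitt path algebra: the vertices, the edges, the ghost edges. -/
inductive LeavittGen (V A : Type*) where
  | vertex (v : V) : LeavittGen V A
  | edge (α : A) : LeavittGen V A
  | ghost (α : A) : LeavittGen V A

namespace LeavittGen

variable {V A : Type*}

/-- The vertex `v` as a word of length one. -/
def vx (v : V) : FreeSemigroup (LeavittGen V A) := FreeSemigroup.of (vertex v)

/-- The edge `α` as a word of length one. -/
def ed (α : A) : FreeSemigroup (LeavittGen V A) := FreeSemigroup.of (edge α)

/-- The ghost edge of `α` as a word of length one. -/
def gh (α : A) : FreeSemigroup (LeavittGen V A) := FreeSemigroup.of (ghost α)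

/-- The word `u α₁ ⋯ αₖ` that represents the path `α₁ ⋯ αₖ` with source `u`. -/
def pathWord (u : V) (l : List A) : FreeSemigroup (LeavittGen V A) :=
  ⟨vertex u, l.map edge⟩

/-- The word `v βₘ* ⋯ β₁*` that represents `η*`, for the path `η = β₁ ⋯ βₘ` with range `v`. -/
def ghostWord (v : V) (l : List A) : FreeSemigroup (LeavittGen V A) :=
  ⟨vertex v, (l.map ghost).reverse⟩

end LeavittGen

section Leavitt

open LeavittGen

variable (R : Type*) [Ring R] {V A : Type*}

/-- The free (non-unital, associative) algebra with coefficients in `R` on the vertices, edges and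
ghost edges; the coefficients commute with the generators. -/
abbrev LeavittFree (V A : Type*) : Type _ := MonoidAlgebra R (FreeSemigroup (LeavittGen V A))

/-- The relators of the Leavitt path algebra, multiplied by arbitrary coefficients `c`, so that
the ideal they generate as a ring ideal is closed under multiplication by coefficients. -/
inductive LeavittRelator (E : DirectedGraph V A) : LeavittFree R V A → Prop
  | vertex_idem (c : R) (v : V) : LeavittRelator E
      (MonoidAlgebra.single (vx v * vx v) c - MonoidAlgebra.single (vx v) c)
  | vertex_orth (c : R) (u v : V) (h : u ≠ v) : LeavittRelator E
      (MonoidAlgebra.single (vx u * vx v) c)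
  | source_edge (c : R) (α : A) : LeavittRelator E
      (MonoidAlgebra.single (vx (E.s α) * ed α) c - MonoidAlgebra.single (ed α) c)
  | edge_range (c : R) (α : A) : LeavittRelator E
      (MonoidAlgebra.single (ed α * vx (E.r α)) c - MonoidAlgebra.single (ed α) c)
  | range_ghost (c : R) (α : A) : LeavittRelator E
      (MonoidAlgebra.single (vx (E.r α) * gh α) c - MonoidAlgebra.single (gh α) c)
  | ghost_source (c : R) (α : A) : LeavittRelator E
      (MonoidAlgebra.single (gh α * vx (E.s α)) c - MonoidAlgebra.single (gh α) c)
  | ghost_edge_self (c : R) (α : A) : LeavittRelator E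
      (MonoidAlgebra.single (gh α * ed α) c - MonoidAlgebra.single (vx (E.r α)) c)
  | ghost_edge_ne (c : R) (α β : A) (h : α ≠ β) : LeavittRelator E
      (MonoidAlgebra.single (gh α * ed β) c)
  | sum_edge_ghost (c : R) (v : V) (h : E.IsRegular v) : LeavittRelator E
      ((∑ α ∈ h.2.toFinset, MonoidAlgebra.single (ed α * gh α) c) - MonoidAlgebra.single (vx v) c)

/-- The two-sided ideal of the free algebra generated by the relators. -/
noncomputable def leavittIdeal (E : DirectedGraph V A) : TwoSidedIdeal (LeavittFree R V A) :=
  TwoSidedIdeal.span {x | LeavittRelator R E x}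

/-- The Leavitt path algebra of `E` with coefficients in `R`. -/
noncomputable def LeavittPathAlgebra (E : DirectedGraph V A) : Type _ := (leavittIdeal R E).ringCon.Quotient

noncomputable instance (E : DirectedGraph V A) : NonUnitalRing (LeavittPathAlgebra R E) :=
  inferInstanceAs (NonUnitalRing (leavittIdeal R E).ringCon.Quotient)

/-- The class in the Leavitt path algebra of an element of the free algebra. -/
noncomputable def LeavittPathAlgebra.mk (E : DirectedGraph V A) (x : LeavittFree R V A) :
    LeavittPathAlgebra R E :=
  RingCon.toQuotient (c := (leavittIdeal R E).ringCon) x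

end Leavitt

/-- The Brandt semigroup over the additive group of integers with index set `I`: the triples
`(i, n, j)` and a zero element. -/
inductive BrandtSemigroup (I : Type*) where
  | zero : BrandtSemigroup I
  | triple (i : I) (n : ℤ) (j : I) : BrandtSemigroup I

namespace BrandtSemigroup

variable {I : Type*}

open Classical in
/-- `(i, m, j) (k, n, l) = (i, m + n, l)` if `j = k`; all other products are zero. -/
protected noncomputable def mul : BrandtSemigroup I → BrandtSemigroup I → BrandtSemigroup I
  | triple i m j, triple k n l => if j = k then triple i (m + n) l else zero
  | _, _ => zero

/-- `(i, n, j)⁻¹ = (j, -n, i)`. -/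
protected def inv : BrandtSemigroup I → BrandtSemigroup I
  | triple i n j => triple j (-n) i
  | zero => zero

noncomputable instance : Mul (BrandtSemigroup I) := ⟨BrandtSemigroup.mul⟩

instance : Zero (BrandtSemigroup I) := ⟨BrandtSemigroup.zero⟩

instance : Inv (BrandtSemigroup I) := ⟨BrandtSemigroup.inv⟩

theorem mul_def (a b : BrandtSemigroup I) : a * b = BrandtSemigroup.mul a b := rfl

noncomputable instance : Semigroup (BrandtSemigroup I) where
  mul_assoc a b c := by
    rcases a with _ | ⟨i, m, j⟩ <;> rcases b with _ | ⟨k, n, l⟩ <;>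
      rcases c with _ | ⟨p, q, t⟩ <;> simp only [mul_def, BrandtSemigroup.mul] <;>
      split_ifs <;> simp_all [add_assoc]

end BrandtSemigroup

/-- A weight mapping that defines a canonical grading by the Brandt semigroup: vertices have
weights `(i, 0, i)` and edges have weights `(i, 1, j)`, compatibly with sources and ranges; edges
whose sources have the same weight have the same weight, and so do edges whose ranges have the
same weight. -/
structure CanonicalWeight {V A : Type*} (E : DirectedGraph V A) (I : Type*) where
  vertex : V → BrandtSemigroup I
  edge : A → BrandtSemigroup I
  vertex_form : ∀ v, ∃ i, vertex v = BrandtSemigroup.triple i 0 i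
  edge_form : ∀ α, ∃ i j, edge α = BrandtSemigroup.triple i 1 j
  source_mul : ∀ α, vertex (E.s α) * edge α = edge α
  mul_range : ∀ α, edge α * vertex (E.r α) = edge α
  edge_eq_of_source : ∀ α β, vertex (E.s α) = vertex (E.s β) → edge α = edge β
  edge_eq_of_range : ∀ α β, vertex (E.r α) = vertex (E.r β) → edge α = edge β

namespace CanonicalWeight

open LeavittGen

variable {V A I : Type*} {E : DirectedGraph V A}

/-- The weight of a generator; the ghost edge of `α` has weight `w(α)⁻¹`. -/
def gen (w : CanonicalWeight E I) : LeavittGen V A → BrandtSemigroup I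
  | .vertex v => w.vertex v
  | .edge α => w.edge α
  | .ghost α => (w.edge α)⁻¹

/-- The weight of a word is the product of the weights of its letters. -/
noncomputable def weight (w : CanonicalWeight E I) :
    FreeSemigroup (LeavittGen V A) →ₙ* BrandtSemigroup I :=
  FreeSemigroup.lift w.gen

/-- The component of degree `d` of the canonical grading: the finite sums of elements `c μ η*`
with `c ∈ R` and paths `μ`, `η` with the same range such that `w(μ η*) = d`. The component of
degree zero is zero. -/
noncomputable def component (R : Type*) [Ring R] (w : CanonicalWeight E I) (d : BrandtSemigroup I) :
    AddSubgroup (LeavittPathAlgebra R E) :=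
  AddSubgroup.closure {x | d ≠ 0 ∧ ∃ (c : R) (u u' v : V) (μ η : List A),
    E.IsPath u μ v ∧ E.IsPath u' η v ∧ w.weight (pathWord u μ * ghostWord v η) = d ∧
    x = LeavittPathAlgebra.mk R E (MonoidAlgebra.single (pathWord u μ * ghostWord v η) c)}

end CanonicalWeight

namespace GradedIdeal

variable {L S : Type*} [NonUnitalRing L]

def IsRightIdeal (J : AddSubgroup L) : Prop := ∀ x ∈ J, ∀ a : L, x * a ∈ J

def IsLeftIdeal (J : AddSubgroup L) : Prop := ∀ x ∈ J, ∀ a : L, a * x ∈ J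

/-- The right ideal generated by `X`: the smallest right ideal that contains `X`. -/
def rightSpan (X : Set L) : AddSubgroup L := sInf {J | IsRightIdeal J ∧ X ⊆ J}

/-- The left ideal generated by `X`: the smallest left ideal that contains `X`. -/
def leftSpan (X : Set L) : AddSubgroup L := sInf {J | IsLeftIdeal J ∧ X ⊆ J}

/-- The product of two ideals: all finite sums of products. -/
def prod (J K : AddSubgroup L) : AddSubgroup L :=
  AddSubgroup.closure {z | ∃ x ∈ J, ∃ y ∈ K, z = x * y}

/-- `powSucc J n` is the ideal power `J ^ (n + 1)`. -/
def powSucc (J : AddSubgroup L) : ℕ → AddSubgroup L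
  | 0 => J
  | n + 1 => prod (powSucc J n) J

/-- An element is homogeneous if it lies in one of the components of the grading `𝒜`. -/
def IsHomogeneousElem (𝒜 : S → AddSubgroup L) (x : L) : Prop := ∃ d, x ∈ 𝒜 d

/-- A homogeneous additive subgroup is the sum of its intersections with the components. -/
def IsHomogeneous (𝒜 : S → AddSubgroup L) (J : AddSubgroup L) : Prop := J = ⨆ d, 𝒜 d ⊓ J

/-- `P` is graded semiprime: `J ^ n ⊆ P` with `n ≥ 1` implies `J ⊆ P`, for all homogeneous
two-sided ideals `J`. -/
def IsGradedSemiprime (𝒜 : S → AddSubgroup L) (P : AddSubgroup L) : Prop :=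
  ∀ J : AddSubgroup L, IsRightIdeal J → IsLeftIdeal J → IsHomogeneous 𝒜 J →
    ∀ n : ℕ, powSucc J n ≤ P → J ≤ P

/-- A graded modular right ideal. -/
def IsGradedModular (𝒜 : S → AddSubgroup L) (J : AddSubgroup L) : Prop :=
  IsRightIdeal J ∧ IsHomogeneous 𝒜 J ∧
    ∃ u, IsHomogeneousElem 𝒜 u ∧ ∀ x, IsHomogeneousElem 𝒜 x → u * x - x ∈ J

/-- A graded modular right ideal that is maximal among the proper homogeneous right ideals. -/
def IsGradedMaximalModular (𝒜 : S → AddSubgroup L) (J : AddSubgroup L) : Prop :=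
  IsGradedModular 𝒜 J ∧ J ≠ ⊤ ∧
    ∀ K : AddSubgroup L, IsRightIdeal K → IsHomogeneous 𝒜 K → J < K → K = ⊤

/-- The graded Jacobson radical: the intersection of all graded maximal modular right ideals. -/
def gradedJacobson (𝒜 : S → AddSubgroup L) : AddSubgroup L :=
  sInf {J | IsGradedMaximalModular 𝒜 J}

end GradedIdeal

/-! Everything follows from graded von Neumann regularity (`exists_inner_inverse_of_mem_component`):
each `x` of degree `d` has an inner inverse `y` of degree `d⁻¹`, so `x * y * x = x`. Then `x * y`
and `y * x` are homogeneous idempotents generating the same right, respectively left, ideal as `x`.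
Further generators are absorbed one at a time by orthogonalising idempotents (`rightSpan_insert`,
`leftSpan_insert`). The identity `x = (x * y) * x` makes homogeneous ideals idempotent, whence
graded semiprimeness. A nonzero radical would contain a nonzero homogeneous idempotent, which Zorn's
lemma excludes (`exists_isGradedMaximalModular`); passing to homogeneous components there needs
directness of the grading, which holds because the relators are homogeneous (`freeProj_mem`).

For regularity, only a finite edge set `F` and a length bound matter for a given `x`. At the target
`v` of a path shorter than the bound, replace `v` by the idempotent `Q = v - ∑ α α*`, summed over
the edges of `F` leaving `v`; at the bound keep `v`. Since `Q` kills every edge of `F`, distinct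
truncated paths become orthogonal, and the elements `c p Q q*` multiply like matrix units with
coefficients in `R` (`unit_mul_unit`, `unit_mul_unit_of_ne`), though some may vanish. The identity
`p q* = p Q q* + ∑ (p α)(q α)*`, iterated up to the bound, writes `x` in these units. McCoy's lemma
then clears the resulting finite matrix by rows and by entries, down to single coefficients, where
regularity of `R` applies. As only finitely many edges enter, the graph can be arbitrary. -/

section Regularity

/-! ### Inner inverses by reduction to rows and columns. -/

variable {T : Type*} [NonUnitalRing T]

/-- McCoy's lemma, relative to a pair of additive subgroups: if `x - x * y * x` has an inner
inverse, then so has `x`. -/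
theorem exists_inner_inverse_of_sub {X Y : AddSubgroup T}
    (hYXY : ∀ y ∈ Y, ∀ x ∈ X, ∀ z ∈ Y, y * x * z ∈ Y) {x y : T} (hx : x ∈ X) (hy : y ∈ Y)
    (h : ∃ z ∈ Y, (x - x * y * x) * z * (x - x * y * x) = x - x * y * x) :
    ∃ z ∈ Y, x * z * x = x := by
  obtain ⟨z, hz, h⟩ := h
  -- The terms containing `z` come from expanding `(x - x*y*x) * z * (x - x*y*x)` as `x * _ * x`;
  -- the term `y` restores the subtracted `x*y*x`.
  refine ⟨y + z - y * x * z - z * x * y + y * x * (z * x * y), ?_, ?_⟩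
  · exact Y.add_mem (Y.sub_mem (Y.sub_mem (Y.add_mem hy hz) (hYXY _ hy _ hx _ hz))
      (hYXY _ hz _ hx _ hy)) (hYXY _ hy _ hx _ (hYXY _ hz _ hx _ hy))
  · have e : x * (y + z - y * x * z - z * x * y + y * x * (z * x * y)) * x
        = x * y * x + (x - x * y * x) * z * (x - x * y * x) := by noncomm_ring
    rw [e, h]; abel

/-- If all the rows `f i * x` have inner inverses, then so have the finite sums of rows. -/
theorem exists_inner_inverse_of_rows {ι : Type*} {X Y : AddSubgroup T}
    (hXYX : ∀ x ∈ X, ∀ y ∈ Y, ∀ z ∈ X, x * y * z ∈ X)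
    (hYXY : ∀ y ∈ Y, ∀ x ∈ X, ∀ z ∈ Y, y * x * z ∈ Y) (f : ι → T)
    (hYf : ∀ i, ∀ y ∈ Y, y * f i ∈ Y)
    (hreg : ∀ i, ∀ x ∈ X, ∃ y ∈ Y, (f i * x) * y * (f i * x) = f i * x) (t : Finset ι) :
    ∀ x ∈ X, x = ∑ i ∈ t, f i * x → ∃ y ∈ Y, x * y * x = x := by
  classical
  induction t using Finset.induction_on with
  | empty =>
    intro x _ h
    rw [Finset.sum_empty] at h
    exact ⟨0, Y.zero_mem, by simp [h]⟩
  | insert a t ha ih =>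
    intro x hx h
    obtain ⟨y, hy, hxy⟩ := hreg a x hx
    have hy' := hYf a y hy
    -- Correcting by `y * f a` rather than `y` annihilates row `a` of `x`, and the remainder is
    -- still the sum of its rows. No orthogonality of the `f i` is needed.
    refine exists_inner_inverse_of_sub hYXY hx hy' (ih _ (X.sub_mem hx (hXYX _ hx _ hy' _ hx)) ?_)
    have h0 : f a * (x - x * (y * f a) * x) = 0 := by
      rw [mul_sub, sub_eq_zero]; nth_rw 1 [← hxy]; noncomm_ring
    have h1 : x - x * (y * f a) * x = ∑ i ∈ insert a t, f i * (x - x * (y * f a) * x) := by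
      have (i : ι) : f i * (x - x * (y * f a) * x) = f i * x - f i * x * ((y * f a) * x) := by
        noncomm_ring
      rw [Finset.sum_congr rfl fun i _ => this i, Finset.sum_sub_distrib, ← Finset.sum_mul _ _ (_ * x),
        ← h, mul_assoc]
    rwa [Finset.sum_insert ha, h0, zero_add] at h1

/-- If all the columns `x * f i` have inner inverses, then so have the finite sums of columns. -/
theorem exists_inner_inverse_of_columns {ι : Type*} {X Y : AddSubgroup T}
    (hXYX : ∀ x ∈ X, ∀ y ∈ Y, ∀ z ∈ X, x * y * z ∈ X)
    (hYXY : ∀ y ∈ Y, ∀ x ∈ X, ∀ z ∈ Y, y * x * z ∈ Y) (f : ι → T)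
    (hfY : ∀ i, ∀ y ∈ Y, f i * y ∈ Y) (p : T → Prop)
    (hp : ∀ x, p x → ∀ z, p (x - x * z * x))
    (hreg : ∀ i, ∀ x ∈ X, p x → ∃ y ∈ Y, (x * f i) * y * (x * f i) = x * f i) (t : Finset ι) :
    ∀ x ∈ X, p x → x = ∑ i ∈ t, x * f i → ∃ y ∈ Y, x * y * x = x := by
  classical
  induction t using Finset.induction_on with
  | empty =>
    intro x _ _ h
    rw [Finset.sum_empty] at h
    exact ⟨0, Y.zero_mem, by simp [h]⟩
  | insert a t ha ih =>
    intro x hx px h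
    obtain ⟨y, hy, hxy⟩ := hreg a x hx px
    have hy' := hfY a y hy
    refine exists_inner_inverse_of_sub hYXY hx hy'
      (ih _ (X.sub_mem hx (hXYX _ hx _ hy' _ hx)) (hp x px _) ?_)
    have h0 : (x - x * (f a * y) * x) * f a = 0 := by
      rw [sub_mul, sub_eq_zero]; nth_rw 1 [← hxy]; noncomm_ring
    have h1 : x - x * (f a * y) * x = ∑ i ∈ insert a t, (x - x * (f a * y) * x) * f i := by
      have (i : ι) : (x - x * (f a * y) * x) * f i = x * f i - x * (f a * y) * (x * f i) := by
        noncomm_ring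
      rw [Finset.sum_congr rfl fun i _ => this i, Finset.sum_sub_distrib,
        ← Finset.mul_sum _ _ (x * _), ← h]
    rwa [Finset.sum_insert ha, h0, zero_add] at h1

end Regularity

/-! ### Arithmetic of the Brandt semigroup. -/

namespace BrandtSemigroup

variable {I : Type*}

theorem triple_mul_triple (i : I) (m : ℤ) (j : I) (n : ℤ) (l : I) :
    triple i m j * triple j n l = triple i (m + n) l := by
  simp [mul_def, BrandtSemigroup.mul]

theorem triple_mul_triple_of_ne {i j k l : I} (m n : ℤ) (h : j ≠ k) :
    triple i m j * triple k n l = 0 := by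
  simp only [mul_def, BrandtSemigroup.mul, if_neg h]; rfl

theorem inv_triple (i : I) (n : ℤ) (j : I) : (triple i n j)⁻¹ = triple j (-n) i := rfl

theorem triple_ne_zero (i : I) (n : ℤ) (j : I) : triple i n j ≠ 0 := nofun

theorem mul_inv_mul (d : BrandtSemigroup I) : d * d⁻¹ * d = d := by
  rcases d with _ | ⟨i, n, j⟩
  · rfl
  · simp [inv_triple, triple_mul_triple]

end BrandtSemigroup

/-! ### One-sided ideals generated by idempotents. -/

namespace GradedIdeal

section Span

variable {L : Type*} [NonUnitalRing L]

theorem subset_rightSpan (X : Set L) : X ⊆ rightSpan X := fun _ hx =>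
  AddSubgroup.mem_sInf.2 fun _ hJ => hJ.2 hx

theorem isRightIdeal_rightSpan (X : Set L) : IsRightIdeal (rightSpan X) := fun _ hx a =>
  AddSubgroup.mem_sInf.2 fun J hJ => hJ.1 _ (AddSubgroup.mem_sInf.1 hx J hJ) a

theorem rightSpan_le {X : Set L} {J : AddSubgroup L} (hJ : IsRightIdeal J) (h : X ⊆ J) :
    rightSpan X ≤ J := sInf_le ⟨hJ, h⟩

theorem subset_leftSpan (X : Set L) : X ⊆ leftSpan X := fun _ hx =>
  AddSubgroup.mem_sInf.2 fun _ hJ => hJ.2 hx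

theorem isLeftIdeal_leftSpan (X : Set L) : IsLeftIdeal (leftSpan X) := fun _ hx a =>
  AddSubgroup.mem_sInf.2 fun J hJ => hJ.1 _ (AddSubgroup.mem_sInf.1 hx J hJ) a

theorem leftSpan_le {X : Set L} {J : AddSubgroup L} (hJ : IsLeftIdeal J) (h : X ⊆ J) :
    leftSpan X ≤ J := sInf_le ⟨hJ, h⟩

theorem rightSpan_singleton_of_inner_inverse {x y : L} (h : x * y * x = x) :
    rightSpan {x} = rightSpan {x * y} := by
  apply le_antisymm <;> apply rightSpan_le (isRightIdeal_rightSpan _) <;>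
    rw [Set.singleton_subset_iff]
  · have := isRightIdeal_rightSpan {x * y} _ (subset_rightSpan _ (Set.mem_singleton _)) x
    rwa [h] at this
  · exact isRightIdeal_rightSpan _ _ (subset_rightSpan _ (Set.mem_singleton _)) y

theorem leftSpan_singleton_of_inner_inverse {x y : L} (h : x * y * x = x) :
    leftSpan {x} = leftSpan {y * x} := by
  apply le_antisymm <;> apply leftSpan_le (isLeftIdeal_leftSpan _) <;>
    rw [Set.singleton_subset_iff]
  · have := isLeftIdeal_leftSpan {y * x} _ (subset_leftSpan _ (Set.mem_singleton _)) x
    rwa [← mul_assoc, h] at this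
  · exact isLeftIdeal_leftSpan _ _ (subset_leftSpan _ (Set.mem_singleton _)) y

/-- Subtracting `a * x` makes the new idempotent `f` satisfy `a * f = 0`; then `f - f * a` is an
idempotent orthogonal to `a` on both sides, so its sum with `a` is idempotent. -/
theorem rightSpan_insert {X : Set L} {a x y : L} (ha : a * a = a)
    (hX : rightSpan X = rightSpan {a}) (h : (x - a * x) * y * (x - a * x) = x - a * x) :
    let f := (x - a * x) * y
    (a + (f - f * a)) * (a + (f - f * a)) = a + (f - f * a) ∧
      rightSpan (insert x X) = rightSpan {a + (f - f * a)} := by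
  intro f
  have haf : a * f = 0 := by
    simp only [f, sub_mul, mul_sub, ← mul_assoc, ha, sub_self]
  have hff : f * f = f := by simp only [f]; rw [← mul_assoc, h]
  have hfa (z : L) : a * (f * z) = 0 := by rw [← mul_assoc, haf, zero_mul]
  have hff' (z : L) : f * (f * z) = f * z := by rw [← mul_assoc, hff]
  -- Right multiplication of the candidate by `a` and by `f` recovers `a` and `f`.
  have hmem {J : AddSubgroup L} (hJ : IsRightIdeal J) : a + (f - f * a) ∈ J ↔ a ∈ J ∧ f ∈ J := by
    refine ⟨fun hg => ?_, fun ⟨h1, h2⟩ => J.add_mem h1 (J.sub_mem h2 (hJ _ h2 a))⟩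
    have h1 : a ∈ J := by
      have := hJ _ hg a
      simpa [add_mul, sub_mul, mul_assoc, ha] using this
    have h2 : f ∈ J := by
      have := hJ _ hg f
      simpa [add_mul, sub_mul, mul_assoc, haf, hff] using this
    exact ⟨h1, h2⟩
  refine ⟨?_, le_antisymm (rightSpan_le (isRightIdeal_rightSpan _) ?_)
    (rightSpan_le (isRightIdeal_rightSpan _) ?_)⟩
  · simp [add_mul, sub_mul, mul_add, mul_sub, mul_assoc, ha, haf, hff, hfa, hff']
  · have hg := (hmem (isRightIdeal_rightSpan _)).1
      (subset_rightSpan _ (Set.mem_singleton (a + (f - f * a))))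
    rw [Set.insert_subset_iff]
    refine ⟨?_, fun z hz => ?_⟩
    · have := AddSubgroup.add_mem _ (isRightIdeal_rightSpan _ _ hg.1 x)
        (isRightIdeal_rightSpan _ _ hg.2 (x - a * x))
      rwa [h, add_sub_cancel] at this
    · have : z ∈ rightSpan {a} := hX ▸ subset_rightSpan _ hz
      exact rightSpan_le (isRightIdeal_rightSpan _) (Set.singleton_subset_iff.2 hg.1) this
  · have hR := isRightIdeal_rightSpan (insert x X)
    have h1 : a ∈ rightSpan (insert x X) := by
      have : a ∈ rightSpan X := hX ▸ subset_rightSpan _ (Set.mem_singleton _)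
      exact rightSpan_le hR ((Set.subset_insert x X).trans (subset_rightSpan _)) this
    have h2 : x ∈ rightSpan (insert x X) := subset_rightSpan _ (Set.mem_insert x X)
    rw [Set.singleton_subset_iff]
    exact (hmem hR).2 ⟨h1, hR _ (AddSubgroup.sub_mem _ h2 (hR _ h1 x)) y⟩

theorem leftSpan_insert {X : Set L} {a x y : L} (ha : a * a = a)
    (hX : leftSpan X = leftSpan {a}) (h : (x - x * a) * y * (x - x * a) = x - x * a) :
    let f := y * (x - x * a)
    (a + (f - a * f)) * (a + (f - a * f)) = a + (f - a * f) ∧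
      leftSpan (insert x X) = leftSpan {a + (f - a * f)} := by
  intro f
  have hfa : f * a = 0 := by
    simp only [f, sub_mul, mul_sub, mul_assoc, ha, sub_self]
  have hff : f * f = f := by simp only [f]; rw [mul_assoc, ← mul_assoc _ y, h]
  have hfa' (z : L) : f * (a * z) = 0 := by rw [← mul_assoc, hfa, zero_mul]
  have haa (z : L) : a * (a * z) = a * z := by rw [← mul_assoc, ha]
  have hmem {J : AddSubgroup L} (hJ : IsLeftIdeal J) : a + (f - a * f) ∈ J ↔ a ∈ J ∧ f ∈ J := by
    refine ⟨fun hg => ?_, fun ⟨h1, h2⟩ => J.add_mem h1 (J.sub_mem h2 (hJ _ h2 a))⟩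
    have h1 : a ∈ J := by
      have := hJ _ hg a
      simpa [mul_add, mul_sub, ha, haa] using this
    have h2 : f ∈ J := by
      have := hJ _ hg f
      simpa [mul_add, mul_sub, hfa, hff, hfa'] using this
    exact ⟨h1, h2⟩
  refine ⟨?_, le_antisymm (leftSpan_le (isLeftIdeal_leftSpan _) ?_)
    (leftSpan_le (isLeftIdeal_leftSpan _) ?_)⟩
  · simp [add_mul, sub_mul, mul_add, mul_sub, mul_assoc, ha, haa, hfa, hff, hfa']
  · have hg := (hmem (isLeftIdeal_leftSpan _)).1
      (subset_leftSpan _ (Set.mem_singleton (a + (f - a * f))))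
    rw [Set.insert_subset_iff]
    refine ⟨?_, fun z hz => ?_⟩
    · have := AddSubgroup.add_mem _ (isLeftIdeal_leftSpan _ _ hg.1 x)
        (isLeftIdeal_leftSpan _ _ hg.2 (x - x * a))
      rwa [← mul_assoc (x - x * a), h, add_sub_cancel] at this
    · have : z ∈ leftSpan {a} := hX ▸ subset_leftSpan _ hz
      exact leftSpan_le (isLeftIdeal_leftSpan _) (Set.singleton_subset_iff.2 hg.1) this
  · have hR := isLeftIdeal_leftSpan (insert x X)
    have h1 : a ∈ leftSpan (insert x X) := by
      have : a ∈ leftSpan X := hX ▸ subset_leftSpan _ (Set.mem_singleton _)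
      exact leftSpan_le hR ((Set.subset_insert x X).trans (subset_leftSpan _)) this
    have h2 : x ∈ leftSpan (insert x X) := subset_leftSpan _ (Set.mem_insert x X)
    rw [Set.singleton_subset_iff]
    exact (hmem hR).2 ⟨h1, hR _ (AddSubgroup.sub_mem _ h2 (hR _ h1 x)) y⟩

end Span

/-! ### Consequences of graded regularity. -/

section Graded

open BrandtSemigroup

variable {L I : Type*} [NonUnitalRing L] {𝒜 : BrandtSemigroup I → AddSubgroup L}

/-- Induction on the number of generators. The condition on `d k` gives `e * d k = d k`, so
subtracting `a * x` preserves the degree, and every idempotent constructed stays in degree `e`. With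
no generators the idempotent is `0`. -/
theorem exists_idempotent_rightSpan
    (hmul : ∀ d d' x y, x ∈ 𝒜 d → y ∈ 𝒜 d' → x * y ∈ 𝒜 (d * d'))
    (hreg : ∀ d, ∀ x ∈ 𝒜 d, ∃ y ∈ 𝒜 d⁻¹, x * y * x = x) {e : BrandtSemigroup I} (he : e * e = e) :
    ∀ (n : ℕ) (x : Fin n → L) (d : Fin n → BrandtSemigroup I), (∀ k, x k ∈ 𝒜 (d k)) →
      (∀ k, d k * (d k)⁻¹ = e) →
      ∃ a ∈ 𝒜 e, a * a = a ∧ rightSpan (Set.range x) = rightSpan {a}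
  | 0, x, _, _, _ => by
    refine ⟨0, (𝒜 e).zero_mem, mul_zero 0, le_antisymm
      (rightSpan_le (isRightIdeal_rightSpan _) ?_) (rightSpan_le (isRightIdeal_rightSpan _) ?_)⟩
    · rintro _ ⟨k, _⟩
      exact k.elim0
    · rw [Set.singleton_subset_iff]
      exact AddSubgroup.zero_mem _
  | n + 1, x, d, hx, hd => by
    obtain ⟨a, hae, ha, hX⟩ := exists_idempotent_rightSpan hmul hreg he n (fun k => x k.succ)
      (fun k => d k.succ) (fun k => hx _) (fun k => hd _)
    have h0 : e * d 0 = d 0 := by rw [← hd 0, mul_inv_mul]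
    have hx' : x 0 - a * x 0 ∈ 𝒜 (d 0) :=
      AddSubgroup.sub_mem _ (hx 0) (h0 ▸ hmul _ _ _ _ hae (hx 0))
    obtain ⟨y, hy, hxy⟩ := hreg _ _ hx'
    have hf : (x 0 - a * x 0) * y ∈ 𝒜 e := hd 0 ▸ hmul _ _ _ _ hx' hy
    have hfa : (x 0 - a * x 0) * y * a ∈ 𝒜 e := by
      have := hmul _ _ _ _ hf hae
      rwa [he] at this
    obtain ⟨h1, h2⟩ := rightSpan_insert ha hX hxy
    refine ⟨_, AddSubgroup.add_mem _ hae (AddSubgroup.sub_mem _ hf hfa), h1, ?_⟩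
    rw [← h2, Fin.range_fin_succ]
    rfl

theorem exists_idempotent_leftSpan
    (hmul : ∀ d d' x y, x ∈ 𝒜 d → y ∈ 𝒜 d' → x * y ∈ 𝒜 (d * d'))
    (hreg : ∀ d, ∀ x ∈ 𝒜 d, ∃ y ∈ 𝒜 d⁻¹, x * y * x = x) {e : BrandtSemigroup I} (he : e * e = e) :
    ∀ (n : ℕ) (x : Fin n → L) (d : Fin n → BrandtSemigroup I), (∀ k, x k ∈ 𝒜 (d k)) →
      (∀ k, (d k)⁻¹ * d k = e) →
      ∃ a ∈ 𝒜 e, a * a = a ∧ leftSpan (Set.range x) = leftSpan {a}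
  | 0, x, _, _, _ => by
    refine ⟨0, (𝒜 e).zero_mem, mul_zero 0, le_antisymm
      (leftSpan_le (isLeftIdeal_leftSpan _) ?_) (leftSpan_le (isLeftIdeal_leftSpan _) ?_)⟩
    · rintro _ ⟨k, _⟩
      exact k.elim0
    · rw [Set.singleton_subset_iff]
      exact AddSubgroup.zero_mem _
  | n + 1, x, d, hx, hd => by
    obtain ⟨a, hae, ha, hX⟩ := exists_idempotent_leftSpan hmul hreg he n (fun k => x k.succ)
      (fun k => d k.succ) (fun k => hx _) (fun k => hd _)
    have h0 : d 0 * e = d 0 := by rw [← hd 0, ← mul_assoc, mul_inv_mul]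
    have hx' : x 0 - x 0 * a ∈ 𝒜 (d 0) := by
      have := hmul _ _ _ _ (hx 0) hae
      rw [h0] at this
      exact AddSubgroup.sub_mem _ (hx 0) this
    obtain ⟨y, hy, hxy⟩ := hreg _ _ hx'
    have hf : y * (x 0 - x 0 * a) ∈ 𝒜 e := hd 0 ▸ hmul _ _ _ _ hy hx'
    have hfa : a * (y * (x 0 - x 0 * a)) ∈ 𝒜 e := by
      have := hmul _ _ _ _ hae hf
      rwa [he] at this
    obtain ⟨h1, h2⟩ := leftSpan_insert ha hX hxy
    refine ⟨_, AddSubgroup.add_mem _ hae (AddSubgroup.sub_mem _ hf hfa), h1, ?_⟩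
    rw [← h2, Fin.range_fin_succ]
    rfl

/-- A homogeneous `x ∈ J` factors as `(x * y) * x` or `x * (y * x)`; on the side where `J` absorbs,
both factors lie in `J`. -/
theorem prod_self_of_isHomogeneous (hreg : ∀ d, ∀ x ∈ 𝒜 d, ∃ y ∈ 𝒜 d⁻¹, x * y * x = x)
    {J : AddSubgroup L} (hJ : IsRightIdeal J ∨ IsLeftIdeal J) (hh : IsHomogeneous 𝒜 J) :
    prod J J = J := by
  apply le_antisymm
  · rw [prod, AddSubgroup.closure_le]
    rintro _ ⟨x, hx, y, hy, rfl⟩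
    exact hJ.elim (fun h => h x hx y) (fun h => h y hy x)
  · conv_lhs => rw [hh]
    refine iSup_le fun d x hx => ?_
    obtain ⟨y, -, hxy⟩ := hreg d x hx.1
    refine AddSubgroup.subset_closure ?_
    rcases hJ with h | h
    · exact ⟨x * y, h x hx.2 y, x, hx.2, hxy.symm⟩
    · exact ⟨x, hx.2, y * x, h x hx.2 y, by rw [← mul_assoc, hxy]⟩

theorem isGradedSemiprime (hreg : ∀ d, ∀ x ∈ 𝒜 d, ∃ y ∈ 𝒜 d⁻¹, x * y * x = x)
    (P : AddSubgroup L) : IsGradedSemiprime 𝒜 P := by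
  intro J hJ _ hh n hn
  have (n : ℕ) : powSucc J n = J := by
    induction n with
    | zero => rfl
    | succ n ih => rw [powSucc, ih, prod_self_of_isHomogeneous hreg (Or.inl hJ) hh]
  rwa [this] at hn

theorem isHomogeneous_iff_le {J : AddSubgroup L} : IsHomogeneous 𝒜 J ↔ J ≤ ⨆ d, 𝒜 d ⊓ J :=
  ⟨fun h => h.le, fun h => le_antisymm h (iSup_le fun _ => inf_le_right)⟩

theorem isHomogeneous_sSup {c : Set (AddSubgroup L)} (hc : ∀ J ∈ c, IsHomogeneous 𝒜 J) :
    IsHomogeneous 𝒜 (sSup c) := by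
  rw [isHomogeneous_iff_le]
  refine sSup_le fun J hJ => (hc J hJ).le.trans (iSup_mono fun d => ?_)
  exact inf_le_inf_left _ (le_sSup hJ)

/-- A homogeneous idempotent `a ≠ 0` lies outside some graded maximal modular right ideal. -/
theorem exists_isGradedMaximalModular (h0 : 𝒜 0 = ⊥)
    (hmul : ∀ d d' x y, x ∈ 𝒜 d → y ∈ 𝒜 d' → x * y ∈ 𝒜 (d * d')) (htop : ⨆ d, 𝒜 d = ⊤)
    {a : L} {e : BrandtSemigroup I} (hae : a ∈ 𝒜 e) (ha : a * a = a) (hne : a ≠ 0) (i : I)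
    (he : e = triple i 0 i) : ∃ J, IsGradedMaximalModular 𝒜 J ∧ a ∉ J := by
  -- The range of `φ` is the smallest right ideal for which `a` is a modular unit; it omits `a`
  -- because `a` annihilates it from the left.
  let φ : L →+ L := AddMonoidHom.id L - AddMonoidHom.mulLeft a
  have hφ (x : L) : φ x = x - a * x := rfl
  have hRight : IsRightIdeal φ.range := by
    rintro _ ⟨x, rfl⟩ b
    exact ⟨x * b, by simp [hφ, sub_mul, mul_assoc]⟩
  have hHom : IsHomogeneous 𝒜 φ.range := by
    rw [isHomogeneous_iff_le, AddMonoidHom.range_eq_map, ← htop, AddSubgroup.map_iSup]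
    refine iSup_mono fun d => le_inf ?_ ?_
    · rintro _ ⟨x, hx, rfl⟩
      refine AddSubgroup.sub_mem _ hx ?_
      -- Left multiplication by `a` preserves each component: either `e * d = d`, or the indices
      -- differ and the product lies in `𝒜 0 = ⊥`.
      have hax := hmul _ _ _ _ hae hx
      change a * x ∈ 𝒜 d
      rcases d with _ | ⟨j, n, k⟩
      · rwa [he] at hax
      · rw [he] at hax
        by_cases hij : i = j
        · subst hij
          rwa [triple_mul_triple, zero_add] at hax
        · rw [triple_mul_triple_of_ne _ _ hij, h0, AddSubgroup.mem_bot] at hax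
          rw [hax]
          exact AddSubgroup.zero_mem _
    · exact le_iSup (fun d => (𝒜 d).map φ) d
  have haφ : a ∉ φ.range := by
    rintro ⟨x, hx⟩
    have := congrArg (a * ·) hx
    simp only [hφ, mul_sub, ← mul_assoc, ha, sub_self] at this
    exact hne this.symm
  have htop' {J : AddSubgroup L} (hJ : IsRightIdeal J) (h1 : φ.range ≤ J) (h2 : a ∈ J) :
      J = ⊤ := by
    refine (AddSubgroup.eq_top_iff' J).2 fun x => ?_
    have := J.add_mem (h1 ⟨x, rfl⟩) (hJ a h2 x)
    rwa [hφ, sub_add_cancel] at this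
  -- Maximality among ideals omitting `a` is maximality among proper ones, since an ideal containing
  -- both `φ.range` and `a` is everything.
  obtain ⟨J, hJ0, hJ⟩ := zorn_le_nonempty₀
    {J : AddSubgroup L | IsRightIdeal J ∧ IsHomogeneous 𝒜 J ∧ a ∉ J} (by
      intro c hcS hc y hy
      have hdir : DirectedOn (· ≤ ·) c := hc.directedOn
      refine ⟨sSup c, ⟨fun x hx b => ?_, isHomogeneous_sSup fun J hJ => (hcS hJ).2.1, ?_⟩,
        fun z hz => le_sSup hz⟩
      · obtain ⟨J, hJ, hxJ⟩ := (AddSubgroup.mem_sSup_of_directedOn ⟨y, hy⟩ hdir).1 hx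
        exact (le_sSup hJ : J ≤ sSup c) ((hcS hJ).1 x hxJ b)
      · intro hx
        obtain ⟨J, hJ, hxJ⟩ := (AddSubgroup.mem_sSup_of_directedOn ⟨y, hy⟩ hdir).1 hx
        exact (hcS hJ).2.2 hxJ) φ.range ⟨hRight, hHom, haφ⟩
  refine ⟨J, ⟨⟨hJ.prop.1, hJ.prop.2.1, a, ⟨e, hae⟩, fun x _ => ?_⟩, ?_, ?_⟩, hJ.prop.2.2⟩
  · have := J.neg_mem (hJ0 ⟨x, rfl⟩)
    rwa [hφ, neg_sub] at this
  · rintro h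
    exact hJ.prop.2.2 (h ▸ AddSubgroup.mem_top a)
  · intro K hK hKh hJK
    refine htop' hK (hJ0.trans hJK.le) ?_
    by_contra haK
    exact hJK.not_ge (hJ.le_of_ge ⟨hK, hKh, haK⟩ hJK.le)

/-- Homogeneous ideals contain the components of their elements. A nonzero component `x` of a
radical element would thus put the nonzero idempotent `x * y` in every graded maximal modular right
ideal. -/
theorem gradedJacobson_eq_bot (h0 : 𝒜 0 = ⊥)
    (hmul : ∀ d d' x y, x ∈ 𝒜 d → y ∈ 𝒜 d' → x * y ∈ 𝒜 (d * d')) (htop : ⨆ d, 𝒜 d = ⊤)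
    (hreg : ∀ d, ∀ x ∈ 𝒜 d, ∃ y ∈ 𝒜 d⁻¹, x * y * x = x) (π : BrandtSemigroup I → L →+ L)
    (hπ : ∀ d x, π d x ∈ 𝒜 d) (hπ_self : ∀ d, ∀ x ∈ 𝒜 d, π d x = x)
    (hπ_ne : ∀ d d', d ≠ d' → ∀ x ∈ 𝒜 d', π d x = 0) (hπ_zero : ∀ x, (∀ d, π d x = 0) → x = 0) :
    gradedJacobson 𝒜 = ⊥ := by
  classical
  rw [AddSubgroup.eq_bot_iff_forall]
  intro z hz
  refine hπ_zero z fun d => ?_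
  have hπJ {J : AddSubgroup L} (hJ : IsHomogeneous 𝒜 J) {x : L} (hx : x ∈ J) : π d x ∈ J := by
    rw [hJ] at hx
    induction hx using AddSubgroup.iSup_induction' with
    | hp d' x hx =>
      by_cases h : d = d'
      · subst h
        rw [hπ_self d x hx.1]
        exact hx.2
      · rw [hπ_ne d d' h x hx.1]
        exact J.zero_mem
    | h1 => rw [map_zero]; exact J.zero_mem
    | hadd x y _ _ h1 h2 => rw [map_add]; exact J.add_mem h1 h2
  by_contra hne
  have hd := hπ d z
  have hmem {J : AddSubgroup L} (hJ : IsGradedMaximalModular 𝒜 J) : π d z ∈ J :=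
    hπJ hJ.1.2.1 (AddSubgroup.mem_sInf.1 hz J hJ)
  obtain ⟨y, hy, hxy⟩ := hreg d _ hd
  have hae := hmul _ _ _ _ hd hy
  rcases d with _ | ⟨i, n, j⟩
  · have hd' : π BrandtSemigroup.zero z ∈ 𝒜 0 := hd
    rw [h0] at hd'
    exact hne hd'
  · obtain ⟨J, hJ, haJ⟩ := exists_isGradedMaximalModular h0 hmul htop hae
      (by rw [← mul_assoc, hxy]) (fun h => hne (by rw [← hxy, h, zero_mul])) i
      (by rw [inv_triple, triple_mul_triple, add_neg_cancel])
    exact haJ (hJ.1.1 _ (hmem hJ) y)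

end Graded

end GradedIdeal

/-! ### Computing with paths and ghost paths in the Leavitt path algebra. -/

open LeavittGen

namespace LeavittPathAlgebra

variable (R : Type*) [Ring R] {V A : Type*} (E : DirectedGraph V A)

theorem mk_mul (x y : LeavittFree R V A) : mk R E (x * y) = mk R E x * mk R E y := rfl

/-- The quotient map as an additive homomorphism. -/
noncomputable def mkHom : LeavittFree R V A →+ LeavittPathAlgebra R E where
  toFun := mk R E
  map_zero' := rfl
  map_add' _ _ := rfl

theorem mkHom_apply (x : LeavittFree R V A) : mkHom R E x = mk R E x := rfl

theorem mkHom_surjective : Function.Surjective (mkHom R E) := Quotient.mk''_surjective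

theorem mk_eq_zero_iff {x : LeavittFree R V A} : mk R E x = 0 ↔ x ∈ leavittIdeal R E := by
  rw [TwoSidedIdeal.mem_iff]
  exact RingCon.eq _

variable {R}

/-- The class of the monomial `c g`, for a coefficient `c` and a word `g`. -/
noncomputable def monomial (c : R) (g : FreeSemigroup (LeavittGen V A)) : LeavittPathAlgebra R E :=
  mk R E (MonoidAlgebra.single g c)

theorem monomial_mul (c d : R) (g h : FreeSemigroup (LeavittGen V A)) :
    monomial E c g * monomial E d h = monomial E (c * d) (g * h) := by
  rw [monomial, monomial, ← mk_mul, MonoidAlgebra.single_mul_single, monomial]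

theorem monomial_add (c d : R) (g : FreeSemigroup (LeavittGen V A)) :
    monomial E (c + d) g = monomial E c g + monomial E d g := by
  rw [monomial, MonoidAlgebra.single_add, ← mkHom_apply, map_add]; rfl

theorem monomial_zero (g : FreeSemigroup (LeavittGen V A)) :
    monomial E (0 : R) g = 0 := by
  rw [monomial, MonoidAlgebra.single_zero, ← mkHom_apply, map_zero]

variable {E}

theorem mk_eq_zero_of_relator {x : LeavittFree R V A} (h : LeavittRelator R E x) :
    mk R E x = 0 :=
  (mk_eq_zero_iff R E).2 (TwoSidedIdeal.subset_span h)

theorem monomial_eq_of_relator {c : R} {g h : FreeSemigroup (LeavittGen V A)}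
    (hr : LeavittRelator R E (MonoidAlgebra.single g c - MonoidAlgebra.single h c)) :
    monomial E c g = monomial E c h := by
  have := mk_eq_zero_of_relator hr
  rwa [← mkHom_apply, map_sub, sub_eq_zero] at this

variable (E)

/-- The vertex `v` with coefficient `c`. -/
noncomputable def vert (c : R) (v : V) : LeavittPathAlgebra R E := monomial E c (vx v)

variable (R)

/-- The edge `α`. -/
noncomputable def edge (α : A) : LeavittPathAlgebra R E := monomial E 1 (ed α)

/-- The ghost edge `α*`. -/
noncomputable def ghost (α : A) : LeavittPathAlgebra R E := monomial E 1 (gh α)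

variable {R E}

theorem vert_mul_vert (c d : R) (v : V) : vert E c v * vert E d v = vert E (c * d) v := by
  rw [vert, vert, monomial_mul]
  exact monomial_eq_of_relator (.vertex_idem _ _)

theorem vert_mul_vert_of_ne (c d : R) {u v : V} (h : u ≠ v) : vert E c u * vert E d v = 0 := by
  rw [vert, vert, monomial_mul]
  exact mk_eq_zero_of_relator (.vertex_orth _ _ _ h)

theorem vert_mul_edge_eq (c : R) (α : A) :
    vert E c (E.s α) * edge R E α = monomial E c (ed α) := by
  rw [vert, edge, monomial_mul, mul_one]
  exact monomial_eq_of_relator (.source_edge _ _)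

theorem edge_mul_vert_eq (c : R) (α : A) :
    edge R E α * vert E c (E.r α) = monomial E c (ed α) := by
  rw [vert, edge, monomial_mul, one_mul]
  exact monomial_eq_of_relator (.edge_range _ _)

theorem vert_mul_ghost_eq (c : R) (α : A) :
    vert E c (E.r α) * ghost R E α = monomial E c (gh α) := by
  rw [vert, ghost, monomial_mul, mul_one]
  exact monomial_eq_of_relator (.range_ghost _ _)

theorem ghost_mul_vert_eq (c : R) (α : A) :
    ghost R E α * vert E c (E.s α) = monomial E c (gh α) := by
  rw [vert, ghost, monomial_mul, one_mul]
  exact monomial_eq_of_relator (.ghost_source _ _)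

theorem vert_mul_edge (c : R) (α : A) :
    vert E c (E.s α) * edge R E α = edge R E α * vert E c (E.r α) := by
  rw [vert_mul_edge_eq, edge_mul_vert_eq]

theorem ghost_mul_vert (c : R) (α : A) :
    ghost R E α * vert E c (E.s α) = vert E c (E.r α) * ghost R E α := by
  rw [vert_mul_ghost_eq, ghost_mul_vert_eq]

theorem one_vert_mul_edge (α : A) : vert E 1 (E.s α) * edge R E α = edge R E α :=
  vert_mul_edge_eq 1 α

theorem edge_mul_one_vert (α : A) : edge R E α * vert E 1 (E.r α) = edge R E α :=
  edge_mul_vert_eq 1 α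

theorem one_vert_mul_ghost (α : A) : vert E 1 (E.r α) * ghost R E α = ghost R E α :=
  vert_mul_ghost_eq 1 α

theorem ghost_mul_one_vert (α : A) : ghost R E α * vert E 1 (E.s α) = ghost R E α :=
  ghost_mul_vert_eq 1 α

theorem ghost_mul_edge (α : A) : ghost R E α * edge R E α = vert E 1 (E.r α) := by
  rw [vert, ghost, edge, monomial_mul, one_mul]
  exact monomial_eq_of_relator (.ghost_edge_self _ _)

theorem ghost_mul_edge_of_ne {α β : A} (h : α ≠ β) : ghost R E α * edge R E β = 0 := by
  rw [ghost, edge, monomial_mul]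
  exact mk_eq_zero_of_relator (.ghost_edge_ne _ _ _ h)

theorem vert_mul_edge_of_ne (c : R) {v : V} {α : A} (h : v ≠ E.s α) :
    vert E c v * edge R E α = 0 := by
  rw [← one_vert_mul_edge, ← mul_assoc, vert_mul_vert_of_ne _ _ h, zero_mul]

theorem edge_mul_vert_of_ne (c : R) {v : V} {α : A} (h : E.r α ≠ v) :
    edge R E α * vert E c v = 0 := by
  rw [← edge_mul_one_vert, mul_assoc, vert_mul_vert_of_ne _ _ h, mul_zero]

theorem ghost_mul_vert_of_ne (c : R) {v : V} {α : A} (h : E.s α ≠ v) :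
    ghost R E α * vert E c v = 0 := by
  rw [← ghost_mul_one_vert, mul_assoc, vert_mul_vert_of_ne _ _ h, mul_zero]

variable (R E)

/-- The element of the Leavitt path algebra given by the path with source `u` and edges `l`. -/
noncomputable def path : V → List A → LeavittPathAlgebra R E
  | u, [] => vert E 1 u
  | _, α :: l => edge R E α * path (E.r α) l

/-- The element `η*`, for the path `η` with source `u` and edges `l`. -/
noncomputable def ghostPath : V → List A → LeavittPathAlgebra R E
  | u, [] => vert E 1 u
  | _, α :: l => ghostPath (E.r α) l * ghost R E α

variable {R E}

theorem vert_mul_path {u v : V} {l : List A} (h : E.IsPath u l v) (c : R) :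
    vert E c u * path R E u l = path R E u l * vert E c v := by
  induction h with
  | nil v => rw [path, vert_mul_vert, vert_mul_vert, mul_one, one_mul]
  | cons α l v h ih => rw [path, ← mul_assoc, vert_mul_edge, mul_assoc, ih, mul_assoc]

theorem vert_mul_ghostPath {u v : V} {l : List A} (h : E.IsPath u l v) (c : R) :
    vert E c v * ghostPath R E u l = ghostPath R E u l * vert E c u := by
  induction h with
  | nil v => rw [ghostPath, vert_mul_vert, vert_mul_vert, mul_one, one_mul]
  | cons α l v h ih => rw [ghostPath, ← mul_assoc, ih, mul_assoc, mul_assoc, ghost_mul_vert]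

theorem one_vert_mul_path {u v : V} {l : List A} (h : E.IsPath u l v) :
    vert E 1 u * path R E u l = path R E u l := by
  cases h with
  | nil v => rw [path, vert_mul_vert, mul_one]
  | cons α l v h => rw [path, ← mul_assoc, one_vert_mul_edge]

theorem path_mul_one_vert {u v : V} {l : List A} (h : E.IsPath u l v) :
    path R E u l * vert E 1 v = path R E u l := by
  rw [← vert_mul_path h, one_vert_mul_path h]

theorem ghostPath_mul_one_vert {u v : V} {l : List A} (h : E.IsPath u l v) :
    ghostPath R E u l * vert E 1 u = ghostPath R E u l := by
  cases h with
  | nil v => rw [ghostPath, vert_mul_vert, mul_one]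
  | cons α l v h => rw [ghostPath, mul_assoc, ghost_mul_one_vert]

theorem one_vert_mul_ghostPath {u v : V} {l : List A} (h : E.IsPath u l v) :
    vert E 1 v * ghostPath R E u l = ghostPath R E u l := by
  rw [vert_mul_ghostPath h, ghostPath_mul_one_vert h]

theorem ghostPath_append {u v : V} {l : List A} (h : E.IsPath u l v) (α : A) (hα : E.s α = v) :
    ghostPath R E u (l ++ [α]) = ghost R E α * ghostPath R E u l := by
  induction h with
  | nil v =>
    subst hα
    rw [List.nil_append, ghostPath, ghostPath, ghostPath, one_vert_mul_ghost, ghost_mul_one_vert]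
  | cons β l v h ih => rw [List.cons_append, ghostPath, ih hα, ghostPath, mul_assoc]

theorem path_append {u v : V} {l : List A} (h : E.IsPath u l v) (α : A) (hα : E.s α = v) :
    path R E u (l ++ [α]) = path R E u l * edge R E α := by
  induction h with
  | nil v =>
    subst hα
    rw [List.nil_append, path, path, path, one_vert_mul_edge, edge_mul_one_vert]
  | cons β l v h ih => rw [List.cons_append, path, ih hα, path, mul_assoc]

theorem isPath_append {u v : V} {l : List A} (h : E.IsPath u l v) (α : A) (hα : E.s α = v) :
    E.IsPath u (l ++ [α]) (E.r α) := by
  induction h with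
  | nil v => subst hα; exact .cons α [] _ (.nil _)
  | cons β l v h ih => exact .cons β _ _ (ih hα)

/-- The bridge between words of the free semigroup and the recursively defined `path` and
`ghostPath`. -/
theorem monomial_foldl (c : R) (g : FreeSemigroup (LeavittGen V A)) (t : List (LeavittGen V A)) :
    t.foldl (fun x a => x * monomial E 1 (FreeSemigroup.of a)) (monomial E c g) =
      monomial E c ⟨g.head, g.tail ++ t⟩ := by
  induction t generalizing g with
  | nil => rw [List.foldl_nil, List.append_nil]
  | cons a t ih =>
    rw [List.foldl_cons, monomial_mul, mul_one, ih]
    simp only [FreeSemigroup.head_mul, FreeSemigroup.tail_mul, FreeSemigroup.of,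
      List.append_assoc, List.singleton_append]

theorem monomial_pathWord {u v : V} {l : List A} (h : E.IsPath u l v) (c : R) :
    monomial E c (pathWord u l) = vert E c u * path R E u l := by
  have key (x : LeavittPathAlgebra R E) (hx : x * vert E 1 u = x) :
      (l.map LeavittGen.edge).foldl (fun x a => x * monomial E 1 (FreeSemigroup.of a)) x =
        x * path R E u l := by
    induction h generalizing x with
    | nil v => rw [path, hx]; rfl
    | cons α l v h ih =>
      rw [List.map_cons, List.foldl_cons, path, ← mul_assoc]
      exact ih (x * edge R E α) (by rw [mul_assoc, edge_mul_one_vert])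
  rw [← key _ (by rw [vert_mul_vert, mul_one]), vert, monomial_foldl]
  rfl

theorem monomial_ghostWord {u v : V} {l : List A} (h : E.IsPath u l v) (c : R) :
    monomial E c (ghostWord v l) = vert E c v * ghostPath R E u l := by
  have := monomial_foldl (E := E) c (vx v) (l.map LeavittGen.ghost).reverse
  rw [List.foldl_reverse] at this
  refine this.symm.trans ?_
  clear this
  induction h with
  | nil v => rw [ghostPath, vert_mul_vert, mul_one]; rfl
  | cons α l v h ih => rw [List.map_cons, List.foldr_cons, ih, ghostPath, mul_assoc]; rfl

/-- The coefficient slides along the path to the common range, giving the normal form used from here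
on. -/
theorem monomial_pathWord_mul_ghostWord {u u' v : V} {l l' : List A} (h : E.IsPath u l v)
    (h' : E.IsPath u' l' v) (c : R) :
    monomial E c (pathWord u l * ghostWord v l') =
      path R E u l * vert E c v * ghostPath R E u' l' := by
  rw [← mul_one c, ← monomial_mul, monomial_pathWord h, monomial_ghostWord h', mul_one,
    ← mul_assoc, mul_assoc (vert E c u), path_mul_one_vert h, vert_mul_path h]

end LeavittPathAlgebra

/-! ### The canonical grading: the components multiply correctly and span. -/

namespace CanonicalWeight

open BrandtSemigroup LeavittPathAlgebra

variable {R : Type*} [Ring R] {V A I : Type*} {E : DirectedGraph V A} (w : CanonicalWeight E I)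

/-- The index `i` of the weight `(i, 0, i)` of a vertex. -/
noncomputable def idx (v : V) : I := (w.vertex_form v).choose

theorem vertex_eq (v : V) : w.vertex v = triple (w.idx v) 0 (w.idx v) :=
  (w.vertex_form v).choose_spec

theorem edge_eq (α : A) : w.edge α = triple (w.idx (E.s α)) 1 (w.idx (E.r α)) := by
  obtain ⟨i, j, h⟩ := w.edge_form α
  have h1 := w.source_mul α
  have h2 := w.mul_range α
  rw [vertex_eq, h] at h1 h2
  have hi : w.idx (E.s α) = i := by
    by_contra hne
    rw [triple_mul_triple_of_ne _ _ hne] at h1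
    exact triple_ne_zero _ _ _ h1.symm
  have hj : j = w.idx (E.r α) := by
    by_contra hne
    rw [triple_mul_triple_of_ne _ _ hne] at h2
    exact triple_ne_zero _ _ _ h2.symm
  rw [h, hi, hj]

theorem weight_mk (a : LeavittGen V A) (t : List (LeavittGen V A)) :
    w.weight ⟨a, t⟩ = t.foldl (fun x b => x * w.gen b) (w.gen a) := rfl

theorem weight_of (a : LeavittGen V A) : w.weight (FreeSemigroup.of a) = w.gen a := rfl

theorem weight_pathWord {u v : V} {l : List A} (h : E.IsPath u l v) :
    w.weight (pathWord u l) = triple (w.idx u) l.length (w.idx v) := by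
  have key (i : I) (n : ℤ) : (l.map LeavittGen.edge).foldl (fun x b => x * w.gen b)
      (triple i n (w.idx u)) = triple i (n + l.length) (w.idx v) := by
    induction h generalizing n with
    | nil v => simp
    | cons α l v h ih =>
      rw [List.map_cons, List.foldl_cons, gen, edge_eq, triple_mul_triple, ih, List.length_cons]
      push_cast
      rw [add_assoc, add_comm (1 : ℤ)]
  rw [pathWord, weight_mk, gen, vertex_eq, key, zero_add]

theorem weight_ghostWord {u v : V} {l : List A} (h : E.IsPath u l v) :
    w.weight (ghostWord v l) = triple (w.idx v) (-l.length) (w.idx u) := by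
  rw [ghostWord, weight_mk, List.foldl_reverse, gen, vertex_eq]
  induction h with
  | nil v => simp
  | cons α l v h ih =>
    rw [List.map_cons, List.foldr_cons, ih, gen, edge_eq, inv_triple, triple_mul_triple,
      List.length_cons]
    push_cast
    rw [neg_add]

theorem weight_pathWord_mul_ghostWord {u u' v : V} {l l' : List A} (h : E.IsPath u l v)
    (h' : E.IsPath u' l' v) : w.weight (pathWord u l * ghostWord v l') =
      triple (w.idx u) (l.length - l'.length) (w.idx u') := by
  rw [map_mul, weight_pathWord w h, weight_ghostWord w h', triple_mul_triple, sub_eq_add_neg]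

variable (R) in
theorem component_zero : w.component R 0 = ⊥ := by
  rw [component, AddSubgroup.closure_eq_bot_iff]
  rintro x ⟨h, -⟩
  exact absurd rfl h

theorem mem_component {u u' v : V} {l l' : List A} (h : E.IsPath u l v) (h' : E.IsPath u' l' v)
    (c : R) {d : BrandtSemigroup I}
    (hd : d = triple (w.idx u) (l.length - l'.length) (w.idx u')) :
    path R E u l * vert E c v * ghostPath R E u' l' ∈ w.component R d := by
  refine AddSubgroup.subset_closure ⟨hd ▸ triple_ne_zero _ _ _, c, u, u', v, l, l', h, h', ?_, ?_⟩
  · rw [weight_pathWord_mul_ghostWord w h h', hd]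
  · exact (monomial_pathWord_mul_ghostWord h h' c).symm

@[elab_as_elim]
theorem component_induction {d : BrandtSemigroup I}
    {p : (x : LeavittPathAlgebra R E) → x ∈ w.component R d → Prop}
    (mem : ∀ (u u' v : V) (l l' : List A) (c : R) (h : E.IsPath u l v) (h' : E.IsPath u' l' v)
      (hd : d = triple (w.idx u) (l.length - l'.length) (w.idx u')),
      p (path R E u l * vert E c v * ghostPath R E u' l') (mem_component w h h' c hd))
    (zero : p 0 (zero_mem _)) (add : ∀ x y hx hy, p x hx → p y hy → p (x + y) (add_mem hx hy))
    (neg : ∀ x hx, p x hx → p (-x) (neg_mem hx))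
    {x : LeavittPathAlgebra R E} (hx : x ∈ w.component R d) : p x hx := by
  induction hx using AddSubgroup.closure_induction with
  | mem x hx =>
    obtain ⟨-, c, u, u', v, l, l', h, h', hd, rfl⟩ := hx
    have := mem u u' v l l' c h h' (by rw [← hd, weight_pathWord_mul_ghostWord w h h'])
    simp only [← monomial_pathWord_mul_ghostWord h h' c] at this
    exact this
  | zero => exact zero
  | add x y _ _ h1 h2 => exact add x y _ _ h1 h2
  | neg x _ h1 => exact neg x _ h1

theorem vertex_mul_mem_component {d : BrandtSemigroup I} {x : LeavittPathAlgebra R E}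
    (hx : x ∈ w.component R d) (v₀ : V) : vert E 1 v₀ * x ∈ w.component R (w.vertex v₀ * d) := by
  induction hx using component_induction with
  | mem u u' v l l' c h h' hd =>
    rw [← mul_assoc, ← mul_assoc]
    by_cases hv : v₀ = u
    · subst hv
      rw [one_vert_mul_path h]
      refine mem_component w h h' c ?_
      rw [hd, vertex_eq, triple_mul_triple, zero_add]
    · rw [← one_vert_mul_path h, ← mul_assoc, vert_mul_vert_of_ne _ _ hv, zero_mul, zero_mul,
        zero_mul]
      exact AddSubgroup.zero_mem _
  | zero => rw [mul_zero]; exact AddSubgroup.zero_mem _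
  | add x y _ _ h1 h2 => rw [mul_add]; exact AddSubgroup.add_mem _ h1 h2
  | neg x _ h1 => rw [mul_neg]; exact AddSubgroup.neg_mem _ h1

theorem edge_mul_mem_component {d : BrandtSemigroup I} {x : LeavittPathAlgebra R E}
    (hx : x ∈ w.component R d) (α : A) :
    LeavittPathAlgebra.edge R E α * x ∈ w.component R (w.edge α * d) := by
  induction hx using component_induction with
  | mem u u' v l l' c h h' hd =>
    rw [← mul_assoc, ← mul_assoc]
    by_cases hv : E.r α = u
    · subst hv
      change path R E (E.s α) (α :: l) * _ * _ ∈ _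
      refine mem_component w (.cons α l v h) h' c ?_
      rw [hd, edge_eq, triple_mul_triple, List.length_cons]
      push_cast
      ring_nf
    · rw [← one_vert_mul_path h, ← mul_assoc, edge_mul_vert_of_ne _ hv, zero_mul, zero_mul,
        zero_mul]
      exact AddSubgroup.zero_mem _
  | zero => rw [mul_zero]; exact AddSubgroup.zero_mem _
  | add x y _ _ h1 h2 => rw [mul_add]; exact AddSubgroup.add_mem _ h1 h2
  | neg x _ h1 => rw [mul_neg]; exact AddSubgroup.neg_mem _ h1

/-- A ghost edge either cancels the first edge of `μ`, kills it, or, when `μ` is trivial, meets `η*`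
and lengthens `η` by one edge at its end or gives zero. -/
theorem ghost_mul_mem_component {d : BrandtSemigroup I} {x : LeavittPathAlgebra R E}
    (hx : x ∈ w.component R d) (α : A) :
    LeavittPathAlgebra.ghost R E α * x ∈ w.component R ((w.edge α)⁻¹ * d) := by
  induction hx using component_induction with
  | mem u u' v l l' c h h' hd =>
    cases h with
    | nil =>
      by_cases hv : E.s α = u
      · subst hv
        have h1 : LeavittPathAlgebra.ghost R E α * (path R E (E.s α) [] * vert E c (E.s α) *
            ghostPath R E u' l') =
            path R E (E.r α) [] * vert E c (E.r α) * ghostPath R E u' (l' ++ [α]) := by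
          rw [path, path, vert_mul_vert, vert_mul_vert, ghostPath_append h' α rfl, ← mul_assoc,
            ghost_mul_vert, mul_assoc]
        rw [h1]
        refine mem_component w (.nil _) (isPath_append h' α rfl) c ?_
        rw [hd, edge_eq, inv_triple, triple_mul_triple, List.length_append, List.length_singleton]
        push_cast
        ring_nf
      · rw [path, ← mul_assoc, ← mul_assoc, ghost_mul_vert_of_ne _ hv, zero_mul, zero_mul]
        exact AddSubgroup.zero_mem _
    | cons β l _ h =>
      rw [path, ← mul_assoc, ← mul_assoc, ← mul_assoc]
      by_cases hαβ : α = β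
      · subst hαβ
        rw [ghost_mul_edge, one_vert_mul_path h]
        refine mem_component w h h' c ?_
        rw [hd, edge_eq, inv_triple, triple_mul_triple, List.length_cons]
        push_cast
        ring_nf
      · rw [ghost_mul_edge_of_ne hαβ, zero_mul, zero_mul, zero_mul]
        exact AddSubgroup.zero_mem _
  | zero => rw [mul_zero]; exact AddSubgroup.zero_mem _
  | add x y _ _ h1 h2 => rw [mul_add]; exact AddSubgroup.add_mem _ h1 h2
  | neg x _ h1 => rw [mul_neg]; exact AddSubgroup.neg_mem _ h1

/-- Letters are multiplied on from the left. In particular words of weight zero vanish in the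
algebra, since the zero component is trivial. -/
theorem monomial_mem_component (c : R) (g : FreeSemigroup (LeavittGen V A)) :
    monomial E c g ∈ w.component R (w.weight g) := by
  induction g using FreeSemigroup.recOnMul with
  | ih1 a =>
    rw [weight_of]
    rcases a with v | α | α
    · have := mem_component w (.nil v) (.nil v) c rfl
      rw [path, ghostPath, vert_mul_vert, vert_mul_vert, one_mul, mul_one, List.length_nil,
        sub_self, ← vertex_eq] at this
      exact this
    · have := mem_component w (.cons α _ _ (.nil _)) (.nil (E.r α)) c rfl
      rw [path, path, edge_mul_one_vert, ghostPath, mul_assoc, vert_mul_vert, mul_one,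
        edge_mul_vert_eq, List.length_nil, List.length_singleton, Nat.cast_one, Nat.cast_zero,
        sub_zero, ← edge_eq] at this
      exact this
    · have := mem_component w (.nil (E.r α)) (.cons α _ _ (.nil _)) c rfl
      rw [ghostPath, ghostPath, one_vert_mul_ghost, path, vert_mul_vert, one_mul,
        vert_mul_ghost_eq, List.length_nil, List.length_singleton, Nat.cast_one, Nat.cast_zero,
        zero_sub, ← inv_triple, ← edge_eq] at this
      exact this
  | ih2 a g _ ih =>
    rw [map_mul, weight_of, ← one_mul c, ← monomial_mul]
    rcases a with v | α | α
    · exact vertex_mul_mem_component w ih v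
    · exact edge_mul_mem_component w ih α
    · exact ghost_mul_mem_component w ih α

theorem mul_mem_component (d d' : BrandtSemigroup I) (x y : LeavittPathAlgebra R E)
    (hx : x ∈ w.component R d) (hy : y ∈ w.component R d') : x * y ∈ w.component R (d * d') := by
  induction hx using component_induction with
  | mem u u' v l l' c h h' hd =>
    induction hy using component_induction with
    | mem u₁ u₁' v₁ l₁ l₁' c₁ h₁ h₁' hd₁ =>
      rw [← monomial_pathWord_mul_ghostWord h h', ← monomial_pathWord_mul_ghostWord h₁ h₁',
        monomial_mul, hd, hd₁, ← weight_pathWord_mul_ghostWord w h h',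
        ← weight_pathWord_mul_ghostWord w h₁ h₁', ← map_mul]
      exact monomial_mem_component w _ _
    | zero => rw [mul_zero]; exact AddSubgroup.zero_mem _
    | add x y _ _ h1 h2 => rw [mul_add]; exact AddSubgroup.add_mem _ h1 h2
    | neg x _ h1 => rw [mul_neg]; exact AddSubgroup.neg_mem _ h1
  | zero => rw [zero_mul]; exact AddSubgroup.zero_mem _
  | add x y _ _ h1 h2 => rw [add_mul]; exact AddSubgroup.add_mem _ h1 h2
  | neg x _ h1 => rw [neg_mul]; exact AddSubgroup.neg_mem _ h1

variable (R) in
theorem iSup_component : ⨆ d, w.component R d = ⊤ := by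
  refine (AddSubgroup.eq_top_iff' _).2 fun x => ?_
  obtain ⟨y, rfl⟩ := mkHom_surjective R E x
  induction y using MonoidAlgebra.induction_linear with
  | zero => rw [map_zero]; exact AddSubgroup.zero_mem _
  | add x y hx hy => rw [map_add]; exact AddSubgroup.add_mem _ hx hy
  | single g c => exact le_iSup (w.component R) _ (monomial_mem_component w c g)

/-! ### Directness of the grading: projections onto the components. -/

open Classical in
variable (R) in
/-- The projection of the free algebra to the span of the words of weight `d`. -/
noncomputable def freeProj (d : BrandtSemigroup I) : LeavittFree R V A →+ LeavittFree R V A :=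
  MonoidAlgebra.coeffAddEquiv.symm.toAddMonoidHom.comp
    ((Finsupp.filterAddHom fun g => w.weight g = d).comp
      MonoidAlgebra.coeffAddEquiv.toAddMonoidHom)

theorem freeProj_single (d : BrandtSemigroup I) (g : FreeSemigroup (LeavittGen V A)) (c : R)
    (h : w.weight g = d) :
    w.freeProj R d (MonoidAlgebra.single g c) = MonoidAlgebra.single g c := by
  classical
  exact congrArg MonoidAlgebra.ofCoeff (Finsupp.filter_single_of_pos _ h)

theorem freeProj_single_of_ne (d : BrandtSemigroup I) (g : FreeSemigroup (LeavittGen V A)) (c : R)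
    (h : w.weight g ≠ d) : w.freeProj R d (MonoidAlgebra.single g c) = 0 := by
  classical
  exact congrArg MonoidAlgebra.ofCoeff (Finsupp.filter_single_of_neg _ h)

theorem exists_sum_freeProj (x : LeavittFree R V A) :
    ∃ t : Finset (BrandtSemigroup I), x = ∑ d ∈ t, w.freeProj R d x := by
  classical
  refine ⟨x.coeff.support.image w.weight, ?_⟩
  apply MonoidAlgebra.coeff_injective
  rw [MonoidAlgebra.coeff_sum]
  ext g
  rw [Finsupp.finsetSum_apply]
  have h (d : BrandtSemigroup I) : (w.freeProj R d x).coeff g =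
      if w.weight g = d then x.coeff g else 0 := by
    change Finsupp.filter (fun g => w.weight g = d) x.coeff g = _
    rw [Finsupp.filter_apply]
  simp only [h]
  rw [Finset.sum_ite_eq]
  split_ifs with hg
  · rfl
  · by_contra hne
    exact hg (Finset.mem_image_of_mem _ (Finsupp.mem_support_iff.2 hne))

/-- The product is already homogeneous, of degree `w.weight g * d'`, so projecting keeps all of it
or nothing. -/
theorem freeProj_single_mul (d d' : BrandtSemigroup I) (g : FreeSemigroup (LeavittGen V A)) (c : R)
    (x : LeavittFree R V A) :
    w.freeProj R d (MonoidAlgebra.single g c * w.freeProj R d' x) = 0 ∨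
      w.freeProj R d (MonoidAlgebra.single g c * w.freeProj R d' x) =
        MonoidAlgebra.single g c * w.freeProj R d' x := by
  by_cases h : w.weight g * d' = d
  · right
    induction x using MonoidAlgebra.induction_linear with
    | zero => simp only [map_zero, mul_zero]
    | add x y hx hy => simp only [map_add, mul_add, hx, hy]
    | single g' c' =>
      by_cases hg : w.weight g' = d'
      · rw [freeProj_single w d' g' c' hg, MonoidAlgebra.single_mul_single, freeProj_single]
        rw [map_mul, hg, h]
      · rw [freeProj_single_of_ne w d' g' c' hg, mul_zero, map_zero]
  · left
    induction x using MonoidAlgebra.induction_linear with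
    | zero => simp only [map_zero, mul_zero]
    | add x y hx hy => simp only [map_add, mul_add, hx, hy, add_zero]
    | single g' c' =>
      by_cases hg : w.weight g' = d'
      · rw [freeProj_single w d' g' c' hg, MonoidAlgebra.single_mul_single, freeProj_single_of_ne]
        rwa [map_mul, hg]
      · rw [freeProj_single_of_ne w d' g' c' hg, mul_zero, map_zero]

theorem freeProj_mul_single (d d' : BrandtSemigroup I) (g : FreeSemigroup (LeavittGen V A)) (c : R)
    (x : LeavittFree R V A) :
    w.freeProj R d (w.freeProj R d' x * MonoidAlgebra.single g c) = 0 ∨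
      w.freeProj R d (w.freeProj R d' x * MonoidAlgebra.single g c) =
        w.freeProj R d' x * MonoidAlgebra.single g c := by
  by_cases h : d' * w.weight g = d
  · right
    induction x using MonoidAlgebra.induction_linear with
    | zero => simp only [map_zero, zero_mul]
    | add x y hx hy => simp only [map_add, add_mul, hx, hy]
    | single g' c' =>
      by_cases hg : w.weight g' = d'
      · rw [freeProj_single w d' g' c' hg, MonoidAlgebra.single_mul_single, freeProj_single]
        rw [map_mul, hg, h]
      · rw [freeProj_single_of_ne w d' g' c' hg, zero_mul, map_zero]
  · left
    induction x using MonoidAlgebra.induction_linear with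
    | zero => simp only [map_zero, zero_mul]
    | add x y hx hy => simp only [map_add, add_mul, hx, hy, add_zero]
    | single g' c' =>
      by_cases hg : w.weight g' = d'
      · rw [freeProj_single w d' g' c' hg, MonoidAlgebra.single_mul_single, freeProj_single_of_ne]
        rwa [map_mul, hg]
      · rw [freeProj_single_of_ne w d' g' c' hg, zero_mul, map_zero]

/-- All words in one relator have the same weight, so a projection returns the relator or zero. -/
theorem freeProj_mem_of_relator {x : LeavittFree R V A} (hx : LeavittRelator R E x)
    (d : BrandtSemigroup I) : w.freeProj R d x ∈ leavittIdeal R E := by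
  have key (d' : BrandtSemigroup I)
      (h : d' = d → w.freeProj R d x = x) (h' : d' ≠ d → w.freeProj R d x = 0) :
      w.freeProj R d x ∈ leavittIdeal R E := by
    by_cases hd : d' = d
    · rw [h hd]
      exact TwoSidedIdeal.subset_span hx
    · rw [h' hd]
      exact TwoSidedIdeal.zero_mem _
  have sing (g : FreeSemigroup (LeavittGen V A)) (c : R) (hg : x = MonoidAlgebra.single g c) :
      w.freeProj R d x ∈ leavittIdeal R E := by
    subst hg
    exact key (w.weight g) (freeProj_single w d g c) (freeProj_single_of_ne w d g c)
  have sub (g g' : FreeSemigroup (LeavittGen V A)) (c : R) (hg : w.weight g = w.weight g')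
      (hx : x = MonoidAlgebra.single g c - MonoidAlgebra.single g' c) :
      w.freeProj R d x ∈ leavittIdeal R E := by
    subst hx
    refine key (w.weight g) (fun h => ?_) (fun h => ?_)
    · rw [map_sub, freeProj_single w d g c h, freeProj_single w d g' c (hg ▸ h)]
    · rw [map_sub, freeProj_single_of_ne w d g c h, freeProj_single_of_ne w d g' c (hg ▸ h),
        sub_zero]
  have wv (v : V) : w.weight (vx v) = triple (w.idx v) 0 (w.idx v) := w.vertex_eq v
  have we (α : A) : w.weight (ed α) = triple (w.idx (E.s α)) 1 (w.idx (E.r α)) := w.edge_eq α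
  have wg (α : A) : w.weight (gh α) = triple (w.idx (E.r α)) (-1) (w.idx (E.s α)) := by
    change (w.edge α)⁻¹ = _
    rw [edge_eq, inv_triple]
  cases hx with
  | vertex_idem c v => exact sub _ _ c (by rw [map_mul, wv, triple_mul_triple, zero_add]) rfl
  | vertex_orth c u v h => exact sing _ c rfl
  | source_edge c α => exact sub _ _ c (by rw [map_mul, wv, we, triple_mul_triple, zero_add]) rfl
  | edge_range c α => exact sub _ _ c (by rw [map_mul, wv, we, triple_mul_triple, add_zero]) rfl
  | range_ghost c α => exact sub _ _ c (by rw [map_mul, wv, wg, triple_mul_triple, zero_add]) rfl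
  | ghost_source c α => exact sub _ _ c (by rw [map_mul, wv, wg, triple_mul_triple, add_zero]) rfl
  | ghost_edge_self c α =>
    exact sub _ _ c (by rw [map_mul, wv, wg, we, triple_mul_triple, neg_add_cancel]) rfl
  | ghost_edge_ne c α β h => exact sing _ c rfl
  | sum_edge_ghost c v h =>
    have hs (α : A) (hα : α ∈ h.2.toFinset) : w.weight (ed α * gh α) = w.weight (vx v) := by
      have : E.s α = v := h.2.mem_toFinset.1 hα
      rw [map_mul, we, wg, triple_mul_triple, add_neg_cancel, wv, this]
    refine key (w.weight (vx v)) (fun hd => ?_) (fun hd => ?_)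
    · rw [map_sub, map_sum, freeProj_single w d _ c hd]
      congr 1
      exact Finset.sum_congr rfl fun α hα => freeProj_single w d _ c ((hs α hα).trans hd)
    · rw [map_sub, map_sum, freeProj_single_of_ne w d _ c hd, sub_zero]
      exact Finset.sum_eq_zero fun α hα =>
        freeProj_single_of_ne w d _ c (fun h' => hd ((hs α hα).symm.trans h'))

theorem freeProj_mem {x : LeavittFree R V A} (hx : x ∈ leavittIdeal R E)
    (d : BrandtSemigroup I) : w.freeProj R d x ∈ leavittIdeal R E := by
  have sum_mem (t : Finset (BrandtSemigroup I)) (f : BrandtSemigroup I → LeavittFree R V A)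
      (hf : ∀ d' ∈ t, f d' ∈ leavittIdeal R E) : ∑ d' ∈ t, f d' ∈ leavittIdeal R E :=
    sum_mem hf
  induction hx using TwoSidedIdeal.span_induction generalizing d with
  | mem x hx => exact freeProj_mem_of_relator w hx d
  | zero => rw [map_zero]; exact TwoSidedIdeal.zero_mem _
  | add x y _ _ hx hy => rw [map_add]; exact TwoSidedIdeal.add_mem _ (hx d) (hy d)
  | neg x _ hx => rw [map_neg]; exact TwoSidedIdeal.neg_mem _ (hx d)
  | left_absorb a x _ hx =>
    induction a using MonoidAlgebra.induction_linear with
    | zero => rw [zero_mul, map_zero]; exact TwoSidedIdeal.zero_mem _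
    | add a b ha hb => rw [add_mul, map_add]; exact TwoSidedIdeal.add_mem _ ha hb
    | single g c =>
      -- Several degrees `d'` can satisfy `w.weight g * d' = d` (when `d = 0`), so `x` is first
      -- split into its components, each in the ideal by induction.
      obtain ⟨t, ht⟩ := w.exists_sum_freeProj x
      rw [ht, Finset.mul_sum, map_sum]
      refine sum_mem _ _ fun d' _ => ?_
      rcases w.freeProj_single_mul d d' g c x with h | h <;> rw [h]
      · exact TwoSidedIdeal.zero_mem _
      · exact TwoSidedIdeal.mul_mem_left _ _ _ (hx d')
  | right_absorb b x _ hx =>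
    induction b using MonoidAlgebra.induction_linear with
    | zero => rw [mul_zero, map_zero]; exact TwoSidedIdeal.zero_mem _
    | add a b ha hb => rw [mul_add, map_add]; exact TwoSidedIdeal.add_mem _ ha hb
    | single g c =>
      obtain ⟨t, ht⟩ := w.exists_sum_freeProj x
      rw [ht, Finset.sum_mul, map_sum]
      refine sum_mem _ _ fun d' _ => ?_
      rcases w.freeProj_mul_single d d' g c x with h | h <;> rw [h]
      · exact TwoSidedIdeal.zero_mem _
      · exact TwoSidedIdeal.mul_mem_right _ _ _ (hx d')

variable (R) in
/-- The projection of the Leavitt path algebra to a component of the canonical grading. -/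
noncomputable def proj (d : BrandtSemigroup I) :
    LeavittPathAlgebra R E →+ LeavittPathAlgebra R E :=
  (mkHom R E).liftOfSurjective (mkHom_surjective R E) ⟨(mkHom R E).comp (w.freeProj R d),
    fun _ hx => (mk_eq_zero_iff R E).2 (w.freeProj_mem ((mk_eq_zero_iff R E).1 hx) d)⟩

theorem proj_mk (d : BrandtSemigroup I) (x : LeavittFree R V A) :
    w.proj R d (mkHom R E x) = mkHom R E (w.freeProj R d x) :=
  AddMonoidHom.liftOfRightInverse_comp_apply _ _ _ _ _

theorem proj_monomial (c : R) (g : FreeSemigroup (LeavittGen V A)) :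
    w.proj R (w.weight g) (monomial E c g) = monomial E c g :=
  (proj_mk w _ _).trans (by rw [freeProj_single w _ g c rfl]; rfl)

theorem proj_monomial_of_ne {d : BrandtSemigroup I} (c : R) (g : FreeSemigroup (LeavittGen V A))
    (h : w.weight g ≠ d) : w.proj R d (monomial E c g) = 0 :=
  (proj_mk w _ _).trans (by rw [freeProj_single_of_ne w _ g c h, map_zero])

theorem proj_mem (d : BrandtSemigroup I) (x : LeavittPathAlgebra R E) :
    w.proj R d x ∈ w.component R d := by
  obtain ⟨y, rfl⟩ := mkHom_surjective R E x
  induction y using MonoidAlgebra.induction_linear with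
  | zero => rw [map_zero, map_zero]; exact AddSubgroup.zero_mem _
  | add x y hx hy => rw [map_add, map_add]; exact AddSubgroup.add_mem _ hx hy
  | single g c =>
    change w.proj R d (monomial E c g) ∈ _
    by_cases h : w.weight g = d
    · rw [← h, proj_monomial]
      exact monomial_mem_component w c g
    · rw [proj_monomial_of_ne w c g h]
      exact AddSubgroup.zero_mem _

theorem proj_of_mem (d : BrandtSemigroup I) (x : LeavittPathAlgebra R E)
    (hx : x ∈ w.component R d) : w.proj R d x = x := by
  induction hx using AddSubgroup.closure_induction with
  | mem x hx =>
    obtain ⟨-, c, u, u', v, l, l', h, h', rfl, rfl⟩ := hx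
    exact proj_monomial w _ _
  | zero => exact map_zero _
  | add x y _ _ h1 h2 => rw [map_add, h1, h2]
  | neg x _ h1 => rw [map_neg, h1]

theorem proj_of_mem_of_ne (d d' : BrandtSemigroup I) (hd : d ≠ d') (x : LeavittPathAlgebra R E)
    (hx : x ∈ w.component R d') : w.proj R d x = 0 := by
  induction hx using AddSubgroup.closure_induction with
  | mem x hx =>
    obtain ⟨-, c, u, u', v, l, l', h, h', rfl, rfl⟩ := hx
    exact proj_monomial_of_ne w _ _ hd.symm
  | zero => exact map_zero _
  | add x y _ _ h1 h2 => rw [map_add, h1, h2, add_zero]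
  | neg x _ h1 => rw [map_neg, h1, neg_zero]

theorem eq_zero_of_proj (x : LeavittPathAlgebra R E) (hx : ∀ d, w.proj R d x = 0) : x = 0 := by
  obtain ⟨y, rfl⟩ := mkHom_surjective R E x
  obtain ⟨t, ht⟩ := w.exists_sum_freeProj y
  rw [ht, map_sum]
  exact Finset.sum_eq_zero fun d _ => (proj_mk w d y).symm.trans (hx d)

end CanonicalWeight

/-! ### Residual idempotents and orthogonality of truncated paths. -/

theorem DirectedGraph.IsPath.tgt_unique {V A : Type*} {E : DirectedGraph V A} {u v v' : V}
    {l : List A} (h : E.IsPath u l v) (h' : E.IsPath u l v') : v = v' := by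
  induction h with
  | nil v => cases h'; rfl
  | cons α l v h ih =>
    -- The source map need not be injective, so the index must become a variable before case
    -- analysis.
    generalize E.s α = u at h'
    cases h' with
    | cons _ _ _ h' => exact ih h'

namespace LeavittPathAlgebra

variable {V A : Type*}

section Residual

variable (R : Type*) [Ring R] (E : DirectedGraph V A)

open Classical in
/-- The part of the vertex `v` that is left by the edges of the finite set `F`. -/
noncomputable def cut (F : Finset A) (v : V) : LeavittPathAlgebra R E :=
  vert E 1 v - ∑ α ∈ F with E.s α = v, edge R E α * ghost R E α

/-- The vertex `v` itself, if no further edges are allowed, and `cut F v` otherwise. -/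
noncomputable def residual (F : Finset A) : ℕ → V → LeavittPathAlgebra R E
  | 0, v => vert E 1 v
  | _ + 1, v => cut R E F v

variable {R E}

theorem vert_mul_cut (F : Finset A) (c : R) (v : V) :
    vert E c v * cut R E F v = cut R E F v * vert E c v := by
  classical
  rw [cut, mul_sub, sub_mul, vert_mul_vert, vert_mul_vert, one_mul, mul_one, Finset.mul_sum,
    Finset.sum_mul]
  congr 1
  refine Finset.sum_congr rfl fun α hα => ?_
  obtain rfl := (Finset.mem_filter.1 hα).2
  rw [← mul_assoc, vert_mul_edge, mul_assoc, mul_assoc, ghost_mul_vert]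

theorem one_vert_mul_cut (F : Finset A) (v : V) :
    vert E 1 v * cut R E F v = cut R E F v := by
  classical
  rw [cut, mul_sub, vert_mul_vert, one_mul, Finset.mul_sum]
  congr 1
  refine Finset.sum_congr rfl fun α hα => ?_
  obtain rfl := (Finset.mem_filter.1 hα).2
  rw [← mul_assoc, one_vert_mul_edge]

/-- If `α` starts at `v`, the only surviving summand is `α α* α = α`, which cancels `v α`; otherwise
every term vanishes. -/
theorem cut_mul_edge {F : Finset A} {α : A} (h : α ∈ F) (v : V) :
    cut R E F v * edge R E α = 0 := by
  classical
  rw [cut, sub_mul, Finset.sum_mul]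
  by_cases hv : E.s α = v
  · rw [Finset.sum_eq_single_of_mem α (Finset.mem_filter.2 ⟨h, hv⟩), mul_assoc, ghost_mul_edge,
      edge_mul_one_vert, ← hv, one_vert_mul_edge, sub_self]
    intro β _ hβ
    rw [mul_assoc, ghost_mul_edge_of_ne hβ, mul_zero]
  · rw [vert_mul_edge_of_ne _ (Ne.symm hv), zero_sub, neg_eq_zero]
    refine Finset.sum_eq_zero fun β hβ => ?_
    have : β ≠ α := fun e => hv (e ▸ (Finset.mem_filter.1 hβ).2)
    rw [mul_assoc, ghost_mul_edge_of_ne this, mul_zero]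

theorem ghost_mul_cut {F : Finset A} {α : A} (h : α ∈ F) (v : V) :
    ghost R E α * cut R E F v = 0 := by
  classical
  rw [cut, mul_sub, Finset.mul_sum]
  by_cases hv : E.s α = v
  · rw [Finset.sum_eq_single_of_mem α (Finset.mem_filter.2 ⟨h, hv⟩), ← mul_assoc, ghost_mul_edge,
      one_vert_mul_ghost, ← hv, ghost_mul_one_vert, sub_self]
    intro β _ hβ
    rw [← mul_assoc, ghost_mul_edge_of_ne hβ.symm, zero_mul]
  · rw [ghost_mul_vert_of_ne _ hv, zero_sub, neg_eq_zero]
    refine Finset.sum_eq_zero fun β hβ => ?_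
    have : α ≠ β := fun e => hv (e ▸ (Finset.mem_filter.1 hβ).2)
    rw [← mul_assoc, ghost_mul_edge_of_ne this, zero_mul]

theorem cut_mul_cut (F : Finset A) (v : V) : cut R E F v * cut R E F v = cut R E F v := by
  classical
  conv_lhs => enter [2]; rw [cut]
  rw [mul_sub, ← vert_mul_cut, one_vert_mul_cut, Finset.mul_sum, Finset.sum_eq_zero, sub_zero]
  intro α hα
  rw [← mul_assoc, cut_mul_edge (Finset.mem_filter.1 hα).1, zero_mul]

theorem vert_mul_residual (F : Finset A) (c : R) (r : ℕ) (v : V) :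
    vert E c v * residual R E F r v = residual R E F r v * vert E c v := by
  cases r with
  | zero => rw [residual, vert_mul_vert, vert_mul_vert, one_mul, mul_one]
  | succ r => exact vert_mul_cut F c v

theorem one_vert_mul_residual (F : Finset A) (r : ℕ) (v : V) :
    vert E 1 v * residual R E F r v = residual R E F r v := by
  cases r with
  | zero => rw [residual, vert_mul_vert, one_mul]
  | succ r => exact one_vert_mul_cut F v

theorem residual_mul_residual (F : Finset A) (r : ℕ) (v : V) :
    residual R E F r v * residual R E F r v = residual R E F r v := by
  cases r with
  | zero => exact one_vert_mul_residual F 0 v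
  | succ r => exact cut_mul_cut F v

theorem ghostPath_mul_path {u v : V} {l : List A} (h : E.IsPath u l v) :
    ghostPath R E u l * path R E u l = vert E 1 v := by
  induction h with
  | nil v => rw [ghostPath, path, vert_mul_vert, one_mul]
  | cons α l v h ih =>
    rw [ghostPath, path, mul_assoc, ← mul_assoc (ghost R E α), ghost_mul_edge,
      one_vert_mul_path h, ih]

/-- Different paths of the same level have orthogonal truncations. -/
theorem residual_mul_ghostPath_mul_path_mul_residual {F : Finset A} {u u' v v' : V}
    {l l' : List A} {r r' : ℕ} (h : E.IsPath u l v) (h' : E.IsPath u' l' v')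
    (hF : ∀ α ∈ l, α ∈ F) (hF' : ∀ α ∈ l', α ∈ F) (hr : l.length + r = l'.length + r')
    (hne : u = u' → l ≠ l') :
    residual R E F r v * (ghostPath R E u l * (path R E u' l' * residual R E F r' v')) = 0 := by
  -- Common initial edges are stripped. Then the sources differ, or the next edges differ and `α* β
  -- = 0`, or one path is exhausted and its residual kills the next edge of the other.
  induction h generalizing u' l' with
  | nil v =>
    cases h' with
    | nil =>
      have hv : v ≠ v' := fun e => hne e rfl
      rw [ghostPath, path, ← mul_assoc (vert E 1 v), vert_mul_vert_of_ne _ _ hv, zero_mul,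
        mul_zero]
    | cons α l' _ h' =>
      -- The exhausted path is strictly shorter, so it is below the bound and its residual is a
      -- `cut`, not a bare vertex.
      obtain ⟨s, rfl⟩ : ∃ s, r = s + 1 := ⟨l'.length + r', by
        rw [List.length_nil, List.length_cons] at hr; omega⟩
      rw [ghostPath, path, residual, ← mul_assoc, ← vert_mul_cut, one_vert_mul_cut, ← mul_assoc,
        ← mul_assoc, cut_mul_edge (hF' α List.mem_cons_self), zero_mul, zero_mul]
  | cons α l v h ih =>
    cases h' with
    | nil =>
      obtain ⟨s, rfl⟩ : ∃ s, r' = s + 1 := ⟨l.length + r, by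
        rw [List.length_nil, List.length_cons] at hr; omega⟩
      rw [ghostPath, path, residual, one_vert_mul_cut, mul_assoc,
        ghost_mul_cut (hF α List.mem_cons_self), mul_zero, mul_zero]
    | cons β l' _ h' =>
      rw [ghostPath, path, mul_assoc (edge R E β), mul_assoc (ghostPath R E (E.r α) l),
        ← mul_assoc (ghost R E α)]
      by_cases hαβ : α = β
      · subst hαβ
        rw [ghost_mul_edge, ← mul_assoc (vert E 1 (E.r α)), one_vert_mul_path h']
        refine ih h' (fun β hβ => hF β (List.mem_cons_of_mem _ hβ))
          (fun β hβ => hF' β (List.mem_cons_of_mem _ hβ)) ?_ fun _ e => hne rfl (by rw [e])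
        rw [List.length_cons, List.length_cons] at hr
        omega
      · rw [ghost_mul_edge_of_ne hαβ, zero_mul, mul_zero, mul_zero]

end Residual

/-! ### Matrix units indexed by bounded paths. -/

variable {I : Type*} {E : DirectedGraph V A}

/-- A path of length at most `M` with edges in `F` and a source of index `i`; `rem` is the
difference between `M` and the length. -/
structure BoundedPath (w : CanonicalWeight E I) (F : Finset A) (i : I) (M : ℕ) where
  src : V
  edges : List A
  tgt : V
  rem : ℕ
  isPath : E.IsPath src edges tgt
  mem : ∀ α ∈ edges, α ∈ F
  idx_src : w.idx src = i
  length_add : edges.length + rem = M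

namespace BoundedPath

variable {w : CanonicalWeight E I} {F : Finset A} {i j k : I} {M N K : ℕ}

theorem eq_of {p q : BoundedPath w F i M} (hs : p.src = q.src) (he : p.edges = q.edges) :
    p = q := by
  obtain ⟨u, l, v, r, h, hF, hi, hl⟩ := p
  obtain ⟨u', l', v', r', h', hF', hi', hl'⟩ := q
  dsimp only at hs he
  subst hs he
  obtain rfl := h.tgt_unique h'
  obtain rfl : r = r' := by omega
  rfl

/-- Two bounded paths match if they have the same target and fall short of their bounds by the
same number of edges. -/
def Match (p : BoundedPath w F i M) (q : BoundedPath w F j N) : Prop :=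
  p.tgt = q.tgt ∧ p.rem = q.rem

variable (R : Type*) [Ring R]

variable {R} in
/-- The element `c p Q q*`, where `Q` is the residual of the target of `p`. -/
noncomputable def unit (c : R) (p : BoundedPath w F i M) (q : BoundedPath w F j N) :
    LeavittPathAlgebra R E :=
  path R E p.src p.edges * vert E c p.tgt *
    (residual R E F p.rem p.tgt * ghostPath R E q.src q.edges)

variable (w F i j M N) in
/-- The span of the elements `c p Q q*` for matching bounded paths `p` and `q`. -/
noncomputable def units : AddSubgroup (LeavittPathAlgebra R E) :=
  AddSubgroup.closure {x | ∃ (c : R) (p : BoundedPath w F i M) (q : BoundedPath w F j N),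
    p.Match q ∧ x = unit c p q}

variable {R}

theorem unit_mem_units (c : R) {p : BoundedPath w F i M} {q : BoundedPath w F j N}
    (h : p.Match q) : unit c p q ∈ units w F i j M N R :=
  AddSubgroup.subset_closure ⟨c, p, q, h, rfl⟩

theorem unit_mul_unit_of_ne (c d : R) {p : BoundedPath w F i M} {q q' : BoundedPath w F j N}
    {p' : BoundedPath w F k K} (h : p.Match q) (hne : q ≠ q') :
    unit c p q * unit d q' p' = 0 := by
  have key := residual_mul_ghostPath_mul_path_mul_residual (R := R) q.isPath q'.isPath q.mem
    q'.mem (q.length_add.trans q'.length_add.symm) (fun hs he => hne (eq_of hs he))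
  obtain ⟨h1, h2⟩ := h
  rw [unit, unit, h1, h2, mul_assoc, mul_assoc (residual R E F _ _),
    mul_assoc (path R E q'.src _), ← mul_assoc (vert E d _), vert_mul_residual,
    mul_assoc (residual R E F _ q'.tgt), ← mul_assoc (path R E q'.src _),
    ← mul_assoc (ghostPath R E q.src _), ← mul_assoc (residual R E F _ q.tgt), key,
    zero_mul, mul_zero]

/-- In the middle, `q* q` collapses to the target vertex; the coefficients commute past the
residual, which is idempotent. -/
theorem unit_mul_unit (c d : R) {p : BoundedPath w F i M} {q : BoundedPath w F j N}
    {p' : BoundedPath w F k K} (h : p.Match q) :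
    unit c p q * unit d q p' = unit (c * d) p p' := by
  obtain ⟨h1, h2⟩ := h
  rw [unit, unit, unit, ← h1, ← h2, mul_assoc, mul_assoc (residual R E F _ _),
    mul_assoc (path R E q.src _), ← mul_assoc (ghostPath R E q.src _) (path R E q.src _),
    ghostPath_mul_path q.isPath, ← h1, ← mul_assoc (vert E 1 _) (vert E d _), vert_mul_vert,
    one_mul, ← mul_assoc (residual R E F _ _) (vert E d _), ← vert_mul_residual,
    mul_assoc (vert E d _), ← mul_assoc (residual R E F _ _) (residual R E F _ _),
    residual_mul_residual, mul_assoc (path R E p.src _), ← mul_assoc (vert E c _),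
    vert_mul_vert, ← mul_assoc]

theorem unit_add (c d : R) (p : BoundedPath w F i M) (q : BoundedPath w F j N) :
    unit (c + d) p q = unit c p q + unit d p q := by
  simp only [unit, vert, monomial_add, mul_add, add_mul]

theorem unit_zero (p : BoundedPath w F i M) (q : BoundedPath w F j N) :
    unit (0 : R) p q = 0 := by
  simp only [unit, vert, monomial_zero, mul_zero, zero_mul]

theorem unit_neg (c : R) (p : BoundedPath w F i M) (q : BoundedPath w F j N) :
    unit (-c) p q = -unit c p q := by
  rw [eq_neg_iff_add_eq_zero, ← unit_add, neg_add_cancel, unit_zero]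

theorem match_refl (p : BoundedPath w F i M) : p.Match p := ⟨rfl, rfl⟩

theorem Match.symm {p : BoundedPath w F i M} {q : BoundedPath w F j N} (h : p.Match q) :
    q.Match p := ⟨h.1.symm, h.2.symm⟩

theorem Match.trans {p : BoundedPath w F i M} {q : BoundedPath w F j N}
    {p' : BoundedPath w F k K} (h : p.Match q) (h' : q.Match p') : p.Match p' :=
  ⟨h.1.trans h'.1, h.2.trans h'.2⟩

theorem mul_mem_units {x y : LeavittPathAlgebra R E} (hx : x ∈ units w F i j M N R)
    (hy : y ∈ units w F j k N K R) : x * y ∈ units w F i k M K R := by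
  induction hx using AddSubgroup.closure_induction with
  | mem x hx =>
    obtain ⟨c, p, q, h, rfl⟩ := hx
    induction hy using AddSubgroup.closure_induction with
    | mem y hy =>
      obtain ⟨d, q', p', h', rfl⟩ := hy
      by_cases hq : q = q'
      · subst hq
        rw [unit_mul_unit c d h]
        exact unit_mem_units _ (h.trans h')
      · rw [unit_mul_unit_of_ne c d h hq]
        exact AddSubgroup.zero_mem _
    | zero => rw [mul_zero]; exact AddSubgroup.zero_mem _
    | add x y _ _ h1 h2 => rw [mul_add]; exact AddSubgroup.add_mem _ h1 h2
    | neg x _ h1 => rw [mul_neg]; exact AddSubgroup.neg_mem _ h1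
  | zero => rw [zero_mul]; exact AddSubgroup.zero_mem _
  | add x y _ _ h1 h2 => rw [add_mul]; exact AddSubgroup.add_mem _ h1 h2
  | neg x _ h1 => rw [neg_mul]; exact AddSubgroup.neg_mem _ h1

/-- With infinitely many vertices there may be infinitely many bounded paths, hence only local
units. Stability under enlarging `t` lets two elements share one finite set. -/
theorem exists_row_sum {x : LeavittPathAlgebra R E} (hx : x ∈ units w F i j M N R) :
    ∃ t : Finset (BoundedPath w F i M), ∀ t', t ⊆ t' → x = ∑ p ∈ t', unit 1 p p * x := by
  classical
  induction hx using AddSubgroup.closure_induction with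
  | mem x hx =>
    obtain ⟨c, p, q, h, rfl⟩ := hx
    refine ⟨{p}, fun t' ht => ?_⟩
    rw [Finset.sum_eq_single_of_mem p (ht (Finset.mem_singleton_self p)),
      unit_mul_unit 1 c p.match_refl, one_mul]
    intro p' _ hp
    exact unit_mul_unit_of_ne 1 c p'.match_refl hp
  | zero => exact ⟨∅, fun t' _ => by simp only [mul_zero, Finset.sum_const_zero]⟩
  | add x y _ _ h1 h2 =>
    obtain ⟨t₁, h1⟩ := h1
    obtain ⟨t₂, h2⟩ := h2
    refine ⟨t₁ ∪ t₂, fun t' ht => ?_⟩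
    simp only [mul_add, Finset.sum_add_distrib]
    rw [← h1 t' (Finset.union_subset_left ht), ← h2 t' (Finset.union_subset_right ht)]
  | neg x _ h1 =>
    obtain ⟨t, h1⟩ := h1
    refine ⟨t, fun t' ht => ?_⟩
    simp only [mul_neg, Finset.sum_neg_distrib]
    rw [← h1 t' ht]

theorem exists_column_sum {x : LeavittPathAlgebra R E} (hx : x ∈ units w F i j M N R) :
    ∃ t : Finset (BoundedPath w F j N), ∀ t', t ⊆ t' → x = ∑ q ∈ t', x * unit 1 q q := by
  classical
  induction hx using AddSubgroup.closure_induction with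
  | mem x hx =>
    obtain ⟨c, p, q, h, rfl⟩ := hx
    refine ⟨{q}, fun t' ht => ?_⟩
    rw [Finset.sum_eq_single_of_mem q (ht (Finset.mem_singleton_self q)),
      unit_mul_unit c 1 h, mul_one]
    intro q' _ hq
    exact unit_mul_unit_of_ne c 1 h hq.symm
  | zero => exact ⟨∅, fun t' _ => by simp only [zero_mul, Finset.sum_const_zero]⟩
  | add x y _ _ h1 h2 =>
    obtain ⟨t₁, h1⟩ := h1
    obtain ⟨t₂, h2⟩ := h2
    refine ⟨t₁ ∪ t₂, fun t' ht => ?_⟩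
    simp only [add_mul, Finset.sum_add_distrib]
    rw [← h1 t' (Finset.union_subset_left ht), ← h2 t' (Finset.union_subset_right ht)]
  | neg x _ h1 =>
    obtain ⟨t, h1⟩ := h1
    refine ⟨t, fun t' ht => ?_⟩
    simp only [neg_mul, Finset.sum_neg_distrib]
    rw [← h1 t' ht]

/-- The coefficient need not be unique, as a residual can vanish; existence suffices. The
alternative `c = 0` covers pairs that do not match. -/
theorem exists_entry {x : LeavittPathAlgebra R E} (hx : x ∈ units w F i j M N R)
    (p : BoundedPath w F i M) (q : BoundedPath w F j N) :
    ∃ c : R, unit 1 p p * x * unit 1 q q = unit c p q ∧ (p.Match q ∨ c = 0) := by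
  induction hx using AddSubgroup.closure_induction with
  | mem x hx =>
    obtain ⟨c, p', q', h, rfl⟩ := hx
    by_cases hp : p = p'
    · subst hp
      rw [unit_mul_unit 1 c p.match_refl, one_mul]
      by_cases hq : q' = q
      · subst hq
        exact ⟨c, by rw [unit_mul_unit c 1 h, mul_one], Or.inl h⟩
      · exact ⟨0, by rw [unit_mul_unit_of_ne c 1 h hq, unit_zero], Or.inr rfl⟩
    · exact ⟨0, by rw [unit_mul_unit_of_ne 1 c p.match_refl hp, zero_mul, unit_zero], Or.inr rfl⟩
  | zero => exact ⟨0, by rw [mul_zero, zero_mul, unit_zero], Or.inr rfl⟩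
  | add x y _ _ h1 h2 =>
    obtain ⟨c, h1, h1'⟩ := h1
    obtain ⟨d, h2, h2'⟩ := h2
    refine ⟨c + d, by rw [mul_add, add_mul, h1, h2, unit_add], ?_⟩
    rcases h1' with h | rfl
    · exact Or.inl h
    · rwa [zero_add]
  | neg x _ h1 =>
    obtain ⟨c, h1, h1'⟩ := h1
    refine ⟨-c, by rw [mul_neg, neg_mul, h1, unit_neg], ?_⟩
    rwa [neg_eq_zero]

/-- Over a von Neumann regular ring, the elements of `units` have inner inverses. -/
theorem exists_inner_inverse_units (hR : ∀ x : R, ∃ y : R, x = x * y * x)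
    {x : LeavittPathAlgebra R E} (hx : x ∈ units w F i j M N R) :
    ∃ y ∈ units w F j i N M R, x * y * x = x := by
  have hXYX : ∀ x ∈ units w F i j M N R, ∀ y ∈ units w F j i N M R, ∀ z ∈ units w F i j M N R,
      x * y * z ∈ units w F i j M N R := fun x hx y hy z hz =>
    mul_mem_units (mul_mem_units hx hy) hz
  have hYXY : ∀ y ∈ units w F j i N M R, ∀ x ∈ units w F i j M N R, ∀ z ∈ units w F j i N M R,
      y * x * z ∈ units w F j i N M R := fun x hx y hy z hz =>
    mul_mem_units (mul_mem_units hx hy) hz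
  obtain ⟨t, ht⟩ := exists_row_sum hx
  refine exists_inner_inverse_of_rows hXYX hYXY (fun p => unit 1 p p)
    (fun p y hy => mul_mem_units hy (unit_mem_units 1 p.match_refl)) ?_ t x hx
    (ht t Finset.Subset.rfl)
  intro p x hx
  have hpx := mul_mem_units (unit_mem_units (1 : R) p.match_refl) hx
  have hpp : unit (1 : R) p p * unit 1 p p = unit 1 p p := by
    rw [unit_mul_unit 1 1 p.match_refl, one_mul]
  obtain ⟨s, hs⟩ := exists_column_sum hpx
  refine exists_inner_inverse_of_columns hXYX hYXY (fun q => unit 1 q q)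
    (fun q y hy => mul_mem_units (unit_mem_units 1 q.match_refl) hy)
    -- The predicate keeps the element inside row `p` during column reduction, so each column of it
    -- is a single matrix entry.
    (fun z => unit 1 p p * z = z) (fun z hz z' => ?_) (fun q z hz hpz => ?_) s _ hpx
    (by rw [← mul_assoc, hpp]) (hs s Finset.Subset.rfl)
  · rw [mul_sub, ← mul_assoc, ← mul_assoc, hz]
  · obtain ⟨c, hc, h⟩ := exists_entry hz p q
    rw [hpz] at hc
    rcases h with h | rfl
    · obtain ⟨c', hc'⟩ := hR c
      refine ⟨unit c' q p, unit_mem_units _ h.symm, ?_⟩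
      rw [hc, unit_mul_unit _ _ h, unit_mul_unit _ _ p.match_refl, ← hc']
    · exact ⟨0, AddSubgroup.zero_mem _, by rw [hc, unit_zero, zero_mul, zero_mul]⟩

open Classical in
theorem path_mul_cut_mul_ghostPath (F : Finset A) (c : R) {u u' v : V} {l l' : List A}
    (h : E.IsPath u l v) (h' : E.IsPath u' l' v) :
    path R E u l * vert E c v * (cut R E F v * ghostPath R E u' l') =
      path R E u l * vert E c v * ghostPath R E u' l' -
        ∑ α ∈ F with E.s α = v, path R E u (l ++ [α]) * vert E c (E.r α) *
          ghostPath R E u' (l' ++ [α]) := by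
  rw [cut, sub_mul, one_vert_mul_ghostPath h', mul_sub, Finset.sum_mul, Finset.mul_sum]
  congr 1
  refine Finset.sum_congr rfl fun α hα => ?_
  have hv := (Finset.mem_filter.1 hα).2
  rw [path_append h α hv, ghostPath_append h' α hv]
  subst hv
  rw [mul_assoc, mul_assoc (edge R E α), ← mul_assoc (vert E c _), vert_mul_edge]
  simp only [mul_assoc]

/-- Matching paths have equal `rem`, so their lengths differ by `M - N`; each term of the expanded
cut lengthens both paths by the same edge and keeps the degree. -/
theorem units_le_component : units w F i j M N R ≤
    w.component R (BrandtSemigroup.triple i (M - N) j) := by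
  classical
  rw [units, AddSubgroup.closure_le]
  rintro _ ⟨c, p, q, ⟨h1, h2⟩, rfl⟩
  obtain ⟨u, l, v, r, h, hF, hi, hl⟩ := p
  obtain ⟨u', l', v', r', h', hF', hi', hl'⟩ := q
  dsimp only at h1 h2
  subst h1 h2 hi hi' hl hl'
  have hd : BrandtSemigroup.triple (w.idx u) (((l.length + r : ℕ) : ℤ) - (l'.length + r : ℕ))
      (w.idx u') = .triple (w.idx u) (l.length - l'.length) (w.idx u') := by
    push_cast
    rw [add_sub_add_right_eq_sub]
  rw [hd]
  have hmem := CanonicalWeight.mem_component w h h' c rfl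
  cases r with
  | zero =>
    rw [unit, residual, one_vert_mul_ghostPath h']
    exact hmem
  | succ r =>
    rw [unit, residual]
    dsimp only
    rw [path_mul_cut_mul_ghostPath F c h h']
    refine AddSubgroup.sub_mem _ hmem (AddSubgroup.sum_mem _ fun α hα => ?_)
    have hv := (Finset.mem_filter.1 hα).2
    refine CanonicalWeight.mem_component w (isPath_append h α hv) (isPath_append h' α hv) c ?_
    simp only [List.length_append, List.length_singleton]
    push_cast
    rw [add_sub_add_right_eq_sub]

/-- Induction on the distance `r` to the bound: split the vertex into its residual, which gives a
unit, and the terms `α α*`, which extend both paths by one edge of `F`. -/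
theorem path_mul_vert_mul_ghostPath_mem_units (c : R) {u u' : V} (hu : w.idx u = i)
    (hu' : w.idx u' = j) (r : ℕ) {v : V} {l l' : List A} (h : E.IsPath u l v)
    (h' : E.IsPath u' l' v) (hF : ∀ α ∈ l, α ∈ F) (hF' : ∀ α ∈ l', α ∈ F)
    (hM : l.length + r = M) (hN : l'.length + r = N) :
    path R E u l * vert E c v * ghostPath R E u' l' ∈ units w F i j M N R := by
  classical
  have hunit := unit_mem_units c (p := ⟨u, l, v, r, h, hF, hu, hM⟩)
    (q := ⟨u', l', v, r, h', hF', hu', hN⟩) ⟨rfl, rfl⟩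
  induction r generalizing v l l' with
  | zero =>
    rw [unit, residual, one_vert_mul_ghostPath h'] at hunit
    exact hunit
  | succ r ih =>
    rw [unit, residual] at hunit
    dsimp only at hunit
    rw [path_mul_cut_mul_ghostPath F c h h'] at hunit
    have hsum : ∑ α ∈ F with E.s α = v, path R E u (l ++ [α]) * vert E c (E.r α) *
        ghostPath R E u' (l' ++ [α]) ∈ units w F i j M N R := by
      refine AddSubgroup.sum_mem _ fun α hα => ?_
      obtain ⟨hαF, hv⟩ := Finset.mem_filter.1 hα
      have hmem {l : List A} (hF : ∀ β ∈ l, β ∈ F) (β : A) (hβ : β ∈ l ++ [α]) : β ∈ F := by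
        rcases List.mem_append.1 hβ with hβ | hβ
        · exact hF β hβ
        · rwa [List.mem_singleton.1 hβ]
      have hlen {l : List A} {M : ℕ} (hM : l.length + (r + 1) = M) :
          (l ++ [α]).length + r = M := by
        rw [List.length_append, List.length_singleton, ← hM]
        omega
      have h1 := isPath_append h α hv
      have h1' := isPath_append h' α hv
      exact ih h1 h1' (hmem hF) (hmem hF') (hlen hM) (hlen hN) (unit_mem_units c ⟨rfl, rfl⟩)
    have := AddSubgroup.add_mem _ hunit hsum
    rwa [sub_add_cancel] at this

/-- The conclusion for all larger `F` and `N` makes the spans directed, so the summands of `x` fit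
into a common one. -/
theorem exists_mem_units {n : ℤ} {x : LeavittPathAlgebra R E}
    (hx : x ∈ w.component R (.triple i n j)) : ∃ (F₀ : Finset A) (N₀ : ℕ), ∀ F, F₀ ⊆ F →
      ∀ M N : ℕ, N₀ ≤ N → (M : ℤ) - N = n → x ∈ units w F i j M N R := by
  classical
  induction hx using CanonicalWeight.component_induction with
  | mem u u' v l l' c h h' hd =>
    injection hd with hi hn hj
    refine ⟨(l ++ l').toFinset, l'.length, fun F hF M N hN hMN => ?_⟩
    refine path_mul_vert_mul_ghostPath_mem_units c hi.symm hj.symm (N - l'.length) h h'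
      (fun α hα => hF (List.mem_toFinset.2 (List.mem_append_left _ hα)))
      (fun α hα => hF (List.mem_toFinset.2 (List.mem_append_right _ hα))) ?_ ?_ <;> omega
  | zero => exact ⟨∅, 0, fun _ _ _ _ _ _ => AddSubgroup.zero_mem _⟩
  | add x y _ _ h1 h2 =>
    obtain ⟨F₁, N₁, h1⟩ := h1
    obtain ⟨F₂, N₂, h2⟩ := h2
    refine ⟨F₁ ∪ F₂, max N₁ N₂, fun F hF M N hN hMN => AddSubgroup.add_mem _ ?_ ?_⟩
    · exact h1 F (Finset.union_subset_left hF) M N (le_of_max_le_left hN) hMN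
    · exact h2 F (Finset.union_subset_right hF) M N (le_of_max_le_right hN) hMN
  | neg x _ h1 =>
    obtain ⟨F₁, N₁, h1⟩ := h1
    exact ⟨F₁, N₁, fun F hF M N hN hMN => AddSubgroup.neg_mem _ (h1 F hF M N hN hMN)⟩

end BoundedPath

/-! ### Graded regularity and the five assertions. -/

/-- The canonical grading is graded von Neumann regular. -/
theorem exists_inner_inverse_of_mem_component {R : Type*} [Ring R]
    (hR : ∀ x : R, ∃ y : R, x = x * y * x) (w : CanonicalWeight E I) (d : BrandtSemigroup I)
    (x : LeavittPathAlgebra R E) (hx : x ∈ w.component R d) :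
    ∃ y ∈ w.component R d⁻¹, x * y * x = x := by
  rcases d with _ | ⟨i, n, j⟩
  · have hx' : x ∈ w.component R 0 := hx
    rw [CanonicalWeight.component_zero, AddSubgroup.mem_bot] at hx'
    exact ⟨0, AddSubgroup.zero_mem _, by rw [hx', zero_mul, zero_mul]⟩
  · obtain ⟨F, N, h⟩ := BoundedPath.exists_mem_units hx
    -- Adding `n.natAbs` to the bound keeps the other bound nonnegative when `n < 0`, so `toNat`
    -- does not truncate.
    have hMN : (((N + n.natAbs + n).toNat : ℕ) : ℤ) - (N + n.natAbs : ℕ) = n := by omega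
    obtain ⟨y, hy, hxy⟩ := BoundedPath.exists_inner_inverse_units hR
      (h F Finset.Subset.rfl _ _ (Nat.le_add_right N n.natAbs) hMN)
    refine ⟨y, ?_, hxy⟩
    have := BoundedPath.units_le_component hy
    rwa [← neg_sub, hMN] at this

end LeavittPathAlgebra

theorem mainTheorem6 {R V A I : Type*} [Ring R]
    (hR : ∀ x : R, ∃ y : R, x = x * y * x)
    (E : DirectedGraph V A) (w : CanonicalWeight E I) :
    (∀ x : LeavittPathAlgebra R E, GradedIdeal.IsHomogeneousElem (w.component R) x →
      (∃ a, GradedIdeal.IsHomogeneousElem (w.component R) a ∧ a * a = a ∧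
        GradedIdeal.rightSpan {x} = GradedIdeal.rightSpan {a}) ∧
      (∃ a, GradedIdeal.IsHomogeneousElem (w.component R) a ∧ a * a = a ∧
        GradedIdeal.leftSpan {x} = GradedIdeal.leftSpan {a})) ∧
    (∀ (n : ℕ) (x : Fin n → LeavittPathAlgebra R E) (d : Fin n → BrandtSemigroup I)
      (e : BrandtSemigroup I), e * e = e → e ≠ 0 → (∀ k, x k ∈ w.component R (d k)) →
      ((∀ k, d k * (d k)⁻¹ = e) →
        ∃ a, GradedIdeal.IsHomogeneousElem (w.component R) a ∧ a * a = a ∧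
          GradedIdeal.rightSpan (Set.range x) = GradedIdeal.rightSpan {a}) ∧
      ((∀ k, (d k)⁻¹ * d k = e) →
        ∃ a, GradedIdeal.IsHomogeneousElem (w.component R) a ∧ a * a = a ∧
          GradedIdeal.leftSpan (Set.range x) = GradedIdeal.leftSpan {a})) ∧
    (∀ J : AddSubgroup (LeavittPathAlgebra R E),
      GradedIdeal.IsRightIdeal J ∨ GradedIdeal.IsLeftIdeal J →
      GradedIdeal.IsHomogeneous (w.component R) J → GradedIdeal.prod J J = J) ∧
    (∀ P : AddSubgroup (LeavittPathAlgebra R E),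
      GradedIdeal.IsRightIdeal P → GradedIdeal.IsLeftIdeal P →
      GradedIdeal.IsHomogeneous (w.component R) P →
      GradedIdeal.IsGradedSemiprime (w.component R) P) ∧
    GradedIdeal.gradedJacobson (w.component R) = ⊥ := by
  have h0 := CanonicalWeight.component_zero R w
  have hmul := CanonicalWeight.mul_mem_component (R := R) w
  have hreg := LeavittPathAlgebra.exists_inner_inverse_of_mem_component hR w
  refine ⟨?_, ?_, ?_, ?_, ?_⟩
  · rintro x ⟨d, hx⟩
    obtain ⟨y, hy, hxy⟩ := hreg d x hx
    exact ⟨⟨x * y, ⟨_, hmul _ _ _ _ hx hy⟩, by rw [← mul_assoc, hxy],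
        GradedIdeal.rightSpan_singleton_of_inner_inverse hxy⟩,
      ⟨y * x, ⟨_, hmul _ _ _ _ hy hx⟩, by rw [mul_assoc, ← mul_assoc x, hxy],
        GradedIdeal.leftSpan_singleton_of_inner_inverse hxy⟩⟩
  · intro n x d e he _ hx
    refine ⟨fun hd => ?_, fun hd => ?_⟩
    · obtain ⟨a, ha, h⟩ := GradedIdeal.exists_idempotent_rightSpan hmul hreg he n x d hx hd
      exact ⟨a, ⟨e, ha⟩, h⟩
    · obtain ⟨a, ha, h⟩ := GradedIdeal.exists_idempotent_leftSpan hmul hreg he n x d hx hd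
      exact ⟨a, ⟨e, ha⟩, h⟩
  · exact fun J hJ hh => GradedIdeal.prod_self_of_isHomogeneous hreg hJ hh
  · exact fun P _ _ _ => GradedIdeal.isGradedSemiprime hreg P
  · exact GradedIdeal.gradedJacobson_eq_bot h0 hmul (CanonicalWeight.iSup_component R w) hreg
      (w.proj R) w.proj_mem w.proj_of_mem w.proj_of_mem_of_ne w.eq_zero_of_proj
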